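/- Setting. Let $\Omega\subset\mathbb R^3$ be a bounded, simply connected, closed domain with Lipschitz boundary $\partial\Omega=\bigcup_{i=1}^I\overline{F_i}$, where every patch $F_i$ is a flat (open) simple quadrilateral and the intersection of two different closed patches is empty, a common edge or a common vertex. Let $\nu_1,\dots,\nu_N$ be the vertices of these quadrilaterals and let $\sigma$ be the surface measure. A function $u:\partial\Omega\to\mathbb C$ belongs to $C^\infty_{\mathrm{pw}}(\partial\Omega)$ if it is continuous and smooth on each closed patch $\overline{F_i}$. Sobolev spaces. $H^0(\partial\Omega)=L_2(\partial\Omega)$. For $0<s<1$, $H^s(\partial\Omega)$ consists of all $u\in L_2(\partial\Omega)$ with $\int_{\partial\Omega}\int_{\partial\Omega}|u(x)-u(y)|^2\,|x-y|^{-2-2s}\,d\sigma(x)\,d\sigma(y)<\infty$. $H^1(\partial\Omega)$ is the closure of $C^\infty_{\mathrm{pw}}(\partial\Omega)$ with respect to the $H^1$-norm, and for $s\ge1$, $H^s(\partial\Omega)=\{u\in H^1(\partial\Omega): u|_{F_i}\in H^s(F_i)\text{ for all }i\}$. Weighted spaces. The faces $\Gamma^{n,t}$ of the tangent cone $\mathcal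 C_n$ at $\nu_n$ are the infinite plane sectors spanned at $\nu_n$ by the patches with corner $\nu_n$. In polar coordinates $(r,\phi)$, $r>0$, $0<\phi<\gamma_{n,t}$, on $\Gamma^{n,t}$ put $q(\phi)=\min\{\phi,\gamma_{n,t}-\phi\}$, and write $f_{n,t}$ for the restriction of a function $f$ on $\partial\mathcal C_n$ to $\Gamma^{n,t}$. For $k\in\mathbb N$ and $0\le\rho\le k$ let $$\|f\,|\,X^k_\rho(\partial\mathcal C_n)\|=\|f\,|\,L_2(\partial\mathcal C_n)\|+\sum_t\ \sum_{1\le\beta_r+\beta_\phi\le k}\Big\|\big(1+\tfrac1r\big)^{\rho}(qr)^{\beta_r}\partial_r^{\beta_r}\,q^{\beta_\phi-\rho}\,\partial_\phi^{\beta_\phi}f_{n,t}\,\Big|\,L_2(\Gamma^{n,t})\Big\| .$$ Let $(\varphi_n)_{n=1}^N$ be a real-valued resolution of unity on $\partial\Omega$ by functions in $C^\infty_{\mathrm{pw}}(\partial\Omega)$ such that $\operatorname{supp}\varphi_n$ meets only closed patches with corner $\nu_n$ and, in each of these, lies in the closed sector at $\nu_n$ and off the two edges that do not contain $\nu_n$.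 Then $X^k_\rho(\partial\Omega)$ is the closure in $L_2(\partial\Omega)$ of $C^\infty_{\mathrm{pw}}(\partial\Omega)$ (more precisely, of its elements of finite norm) with respect to $\|u\,|\,X^k_\rho(\partial\Omega)\|=\sum_{n=1}^N\|\varphi_n u\,|\,X^k_\rho(\partial\mathcal C_n)\|$, where $\varphi_nu$ is extended by zero to $\partial\mathcal C_n$. Here, as for $H^1(\partial\Omega)$, "closure" means the set of all $L_2$-limits of sequences that are Cauchy in the given norm. Proposition. Let $\nu$ be one of the vertices of $\partial\Omega$, let $1/2\le\alpha<1$, and let $g(x)=|x-\nu|^{-\alpha}$, restricted to $\partial\Omega$. Then $$g\in H^s(\partial\Omega)\cap X^1_\rho(\partial\Omega)\qquad\text{for all } 0\le s<1-\alpha\text{ and all }0\le\rho<1-\alpha,$$ but $g\notin H^s(\partial\Omega)$ for every $s\ge1-\alpha$. -/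

import Mathlib

open MeasureTheory Filter Topology Set
open scoped ENNReal NNReal ContDiff ComplexConjugate

noncomputable section

/-- Euclidean three-space. -/
abbrev E3 : Type := EuclideanSpace ℝ (Fin 3)

/-! ### Plane quadrilaterals

The plane is `ℂ` with its Euclidean structure and Lebesgue measure. -/

/-- The four points `c 0, c 1, c 2, c 3` are, in counterclockwise cyclic order, the corners of a
simple quadrilateral with inner diagonal from `c 0` to `c 2`: both triangles into which this
diagonal cuts it are positively oriented. Every simple quadrilateral, convex or not, has an inner
diagonal, so up to the numbering of its corners and a reflection it is of this form. -/
def IsQuad (c : Fin 4 → ℂ) : Prop :=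
  0 < (conj (c 1 - c 0) * (c 2 - c 0)).im ∧ 0 < (conj (c 2 - c 0) * (c 3 - c 0)).im

/-- The closed region bounded by the polygonal chain `c 0, c 1, c 2, c 3, c 0`. -/
def quad (c : Fin 4 → ℂ) : Set ℂ :=
  convexHull ℝ {c 0, c 1, c 2} ∪ convexHull ℝ {c 0, c 2, c 3}

/-- The closed edge from the corner `c k` to the next one (indices modulo four). -/
def quadEdge (c : Fin 4 → ℂ) (k : Fin 4) : Set ℂ := segment ℝ (c k) (c (k + 1))

/-- The interior angle at the corner `c k`, a number in `(0, 2π)`: the counterclockwise angle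
from the edge towards `c (k + 1)` to the edge towards `c (k - 1)`. -/
def cornerAngle (c : Fin 4 → ℂ) (k : Fin 4) : ℝ :=
  toIcoMod Real.two_pi_pos 0 (Complex.arg ((c (k - 1) - c k) / (c (k + 1) - c k)))

/-- Polar coordinates `(r, θ)` centred at the corner `c k`; the ray `θ = 0` contains the edge
towards `c (k + 1)`, the ray `θ = cornerAngle c k` the edge towards `c (k - 1)`. -/
def cornerPolar (c : Fin 4 → ℂ) (k : Fin 4) (r θ : ℝ) : ℂ :=
  c k + (r : ℂ) * Complex.exp ((θ : ℂ) * Complex.I)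
    * ((c (k + 1) - c k) / ((‖c (k + 1) - c k‖ : ℝ) : ℂ))

/-- The closed infinite plane sector spanned by the quadrilateral at its corner `c k`. -/
def cornerSector (c : Fin 4 → ℂ) (k : Fin 4) : Set ℂ :=
  {y | ∃ r θ : ℝ, 0 ≤ r ∧ 0 ≤ θ ∧ θ ≤ cornerAngle c k ∧ y = cornerPolar c k r θ}

/-- The part of the quadrilateral that lies in the sector of the corner `c k` and off the two
edges that do not contain `c k`. -/
def cornerStar (c : Fin 4 → ℂ) (k : Fin 4) : Set ℂ :=
  (quad c ∩ cornerSector c k) \ (quadEdge c (k + 1) ∪ quadEdge c (k + 2))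

/-! ### Polyhedral Lipschitz surfaces -/

/-- `Ω` has a Lipschitz boundary: near each boundary point it is, in a direction `n`, the closed
epigraph of a Lipschitz function `h` of the variables orthogonal to `n`. -/
def HasLipschitzBoundary (Ω : Set E3) : Prop :=
  ∀ x ∈ frontier Ω, ∃ (n : E3) (K : ℝ≥0) (h : E3 → ℝ), ‖n‖ = 1 ∧ LipschitzWith K h ∧
    (∀ (y : E3) (t : ℝ), h (y + t • n) = h y) ∧
    ∀ᶠ y in 𝓝 x, (y ∈ Ω ↔ h y ≤ inner ℝ n y)

/-- A bounded, simply connected, closed domain in three-space with Lipschitz boundary, together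
with a conforming decomposition of the boundary into finitely many flat quadrilateral patches.
The patch `i` is the image of the plane quadrilateral with corners `corner i` under the isometric
affine embedding `chart i`. -/
structure PolyhedralSurface where
  Ω : Set E3
  isCompact : IsCompact Ω
  closure_interior : closure (interior Ω) = Ω
  isConnected_interior : IsConnected (interior Ω)
  simplyConnected : SimplyConnectedSpace Ω
  lipschitz : HasLipschitzBoundary Ω
  numPatches : ℕ
  chart : Fin numPatches → (ℂ →ᵃⁱ[ℝ] E3)
  corner : Fin numPatches → Fin 4 → ℂ
  isQuad : ∀ i, IsQuad (corner i)
  frontier_eq : frontier Ω = ⋃ i, chart i '' quad (corner i)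
  conforming : ∀ i j, i ≠ j →
    (chart i '' quad (corner i)) ∩ (chart j '' quad (corner j)) = ∅ ∨
    (∃ k l, (chart i '' quad (corner i)) ∩ (chart j '' quad (corner j))
        = chart i '' quadEdge (corner i) k ∧
      chart i '' quadEdge (corner i) k = chart j '' quadEdge (corner j) l) ∨
    (∃ k l, (chart i '' quad (corner i)) ∩ (chart j '' quad (corner j))
        = {chart i (corner i k)} ∧
      chart i (corner i k) = chart j (corner j l))

namespace PolyhedralSurface

variable (S : PolyhedralSurface)

/-- The surface `∂Ω`. Functions on it are represented by functions on three-space of which only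
the values on `∂Ω` matter. -/
def surface : Set E3 := frontier S.Ω

/-- The closed patch `i`. -/
def closedPatch (i : Fin S.numPatches) : Set E3 := S.chart i '' quad (S.corner i)

/-- The open patch `i` in its plane coordinates. -/
def flatPatch (i : Fin S.numPatches) : Set ℂ := interior (quad (S.corner i))

/-- The point of three-space that is the corner `p.2` of the patch `p.1`. -/
def cornerPoint (p : Fin S.numPatches × Fin 4) : E3 := S.chart p.1 (S.corner p.1 p.2)

open Classical in
/-- The finite set of all vertices. -/
def vertices : Finset E3 := Finset.univ.image S.cornerPoint

open Classical in
/-- The faces of the tangent cone at `ν`: one infinite plane sector for each patch with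
corner `ν`. -/
def facesAt (ν : E3) : Finset (Fin S.numPatches × Fin 4) :=
  Finset.univ.filter fun p => S.cornerPoint p = ν

/-- The surface measure on `∂Ω`. -/
def surfaceMeasure : Measure E3 :=
  ∑ i, (volume.restrict (S.flatPatch i)).map (S.chart i)

/-- Patchwise smooth functions: globally continuous on the surface, and smooth up to the boundary
on each closed patch. -/
def PwSmooth (u : E3 → ℂ) : Prop :=
  ContinuousOn u S.surface ∧
    ∀ i, ∃ U : ℂ → ℂ, ContDiff ℝ ∞ U ∧ ∀ y ∈ quad (S.corner i), u (S.chart i y) = U y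

/-! ### Unweighted Sobolev spaces -/

end PolyhedralSurface

/-- The squared Slobodeckij seminorm of order `θ ∈ (0, 1)` over a two-dimensional set that carries
the measure `μ`. -/
def slobodeckij {X : Type*} [PseudoEMetricSpace X] [MeasurableSpace X] (μ : Measure X) (θ : ℝ)
    (u : X → ℂ) : ℝ≥0∞ :=
  ∫⁻ x, ∫⁻ y, ‖u x - u y‖ₑ ^ 2 / edist x y ^ (2 + 2 * θ) ∂μ ∂μ

/-- `w` is the weak derivative of `v` in direction `e` on the open plane set `P`. -/
def IsWeakDeriv (P : Set ℂ) (e : ℂ) (v w : ℂ → ℂ) : Prop :=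
  ∀ ψ : ℂ → ℝ, ContDiff ℝ ∞ ψ → HasCompactSupport ψ → tsupport ψ ⊆ P →
    ∫ y in P, (fderiv ℝ ψ y e) • v y = - ∫ y in P, ψ y • w y

/-- Membership in the Sobolev space `H^(m + θ)(P)` of an open plane set `P`, for `m` a natural
number and `θ ∈ [0, 1)`: the weak derivatives up to order `m` are square integrable and, if
`θ > 0`, those of order `m` have finite Slobodeckij seminorm of order `θ`. -/
def MemHPlane (P : Set ℂ) (θ : ℝ) : ℕ → (ℂ → ℂ) → Prop
  | 0, v => MemLp v 2 (volume.restrict P) ∧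
      (0 < θ → slobodeckij (volume.restrict P) θ v < ⊤)
  | m + 1, v => MemLp v 2 (volume.restrict P) ∧
      (∃ w, IsWeakDeriv P 1 v w ∧ MemHPlane P θ m w) ∧
      (∃ w, IsWeakDeriv P Complex.I v w ∧ MemHPlane P θ m w)

namespace PolyhedralSurface

variable (S : PolyhedralSurface)

/-- The squared `L₂` norm of the tangential gradient of a patchwise smooth function. -/
def gradNormSq (u : E3 → ℂ) : ℝ≥0∞ :=
  ∑ i, ∫⁻ y in S.flatPatch i,
    (‖fderiv ℝ (fun z => u (S.chart i z)) y 1‖ₑ ^ 2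
      + ‖fderiv ℝ (fun z => u (S.chart i z)) y Complex.I‖ₑ ^ 2)

/-- Membership in `H¹(∂Ω)`, the closure in `L₂(∂Ω)` of the patchwise smooth functions with respect
to the `H¹` norm. -/
def MemHOne (u : E3 → ℂ) : Prop :=
  MemLp u 2 S.surfaceMeasure ∧
    ∃ U : ℕ → E3 → ℂ, (∀ j, S.PwSmooth (U j)) ∧
      (∀ ε : ℝ≥0∞, 0 < ε → ∃ J, ∀ j ≥ J, ∀ l ≥ J, S.gradNormSq (U j - U l) < ε) ∧
      Tendsto (fun j => eLpNorm (U j - u) 2 S.surfaceMeasure) atTop (𝓝 0)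

/-- Membership in the Sobolev space `H^s(∂Ω)`, `s ≥ 0`. For `s = 0` this is `L₂(∂Ω)`; for
`0 < s < 1` it is the Sobolev-Slobodeckij space; for `s ≥ 1` it consists of the functions in
`H¹(∂Ω)` whose restriction to each patch has Sobolev smoothness `s`. -/
def MemH (s : ℝ) (u : E3 → ℂ) : Prop :=
  MemLp u 2 S.surfaceMeasure ∧
    (0 < s → s < 1 → slobodeckij S.surfaceMeasure s u < ⊤) ∧
    (1 ≤ s → S.MemHOne u ∧
      ∀ i, MemHPlane (S.flatPatch i) (s - ⌊s⌋₊) ⌊s⌋₊ (fun y => u (S.chart i y)))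

/-! ### Weighted Sobolev spaces -/

/-- A smooth resolution of unity `(φ ν)` on the surface, indexed by the vertices `ν` and
subordinate to the faces of the tangent cones: the support of `φ ν` meets only patches with
corner `ν`, and in such a patch it stays within the sector at `ν` and off the two edges that do
not contain `ν`. -/
structure IsVertexPartition (φ : E3 → E3 → ℝ) : Prop where
  pwSmooth : ∀ ν ∈ S.vertices, S.PwSmooth (fun x => (φ ν x : ℂ))
  sum_eq_one : ∀ x ∈ S.surface, ∑ ν ∈ S.vertices, φ ν x = 1
  support : ∀ ν ∈ S.vertices, ∀ x ∈ closure {x | x ∈ S.surface ∧ φ ν x ≠ 0}, ∀ i,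
    x ∈ S.closedPatch i →
      ∃ k, S.cornerPoint (i, k) = ν ∧ x ∈ S.chart i '' cornerStar (S.corner i) k

/-- A function on the surface, in the polar coordinates of the face `p` of a tangent cone, and
extended by zero from the patch to the whole face. -/
def faceFun (p : Fin S.numPatches × Fin 4) (f : E3 → ℂ) (r θ : ℝ) : ℂ :=
  (quad (S.corner p.1)).indicator (fun y => f (S.chart p.1 y))
    (cornerPolar (S.corner p.1) p.2 r θ)

end PolyhedralSurface

/-- The squared `L₂` norm of a function, given in polar coordinates, over the open plane sector of
opening angle `γ`. -/
def sectorNormSq (γ : ℝ) (F : ℝ → ℝ → ℂ) : ℝ≥0∞ :=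
  ∫⁻ r in Ioi (0 : ℝ), ∫⁻ θ in Ioo (0 : ℝ) γ, ‖F r θ‖ₑ ^ 2 * ENNReal.ofReal r

/-- The angular distance to the boundary of the sector of opening angle `γ`. -/
def angularDist (γ θ : ℝ) : ℝ := min θ (γ - θ)

/-- The weighted derivative
`(1 + 1/r)^ρ (q r)^a (∂/∂r)^a q^(b - ρ) (∂/∂θ)^b f`, with `q = min {θ, γ - θ}`, of a function `f`
given in polar coordinates. -/
def weightedDeriv (γ ρ : ℝ) (a b : ℕ) (f : ℝ → ℝ → ℂ) (r θ : ℝ) : ℂ :=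
  ((1 + 1 / r) ^ ρ * (angularDist γ θ * r) ^ a : ℝ) •
    iteratedDeriv a
      (fun r' => (angularDist γ θ ^ ((b : ℝ) - ρ) : ℝ) • iteratedDeriv b (f r') θ) r

namespace PolyhedralSurface

variable (S : PolyhedralSurface)

/-- The norm of `X^k_ρ` on the boundary of the tangent cone at `ν`, for a function on the surface
that is supported close to `ν`. -/
def coneNorm (k : ℕ) (ρ : ℝ) (ν : E3) (f : E3 → ℂ) : ℝ≥0∞ :=
  (∑ p ∈ S.facesAt ν, sectorNormSq (cornerAngle (S.corner p.1) p.2) (S.faceFun p f))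
      ^ (1 / 2 : ℝ) +
    ∑ p ∈ S.facesAt ν, ∑ m ∈ Finset.Icc 1 k, ∑ β ∈ Finset.HasAntidiagonal.antidiagonal m,
      (sectorNormSq (cornerAngle (S.corner p.1) p.2)
        (weightedDeriv (cornerAngle (S.corner p.1) p.2) ρ β.1 β.2 (S.faceFun p f)))
        ^ (1 / 2 : ℝ)

/-- The norm of `X^k_ρ(∂Ω)`, for patchwise smooth functions and the resolution of unity `φ`. -/
def normX (φ : E3 → E3 → ℝ) (k : ℕ) (ρ : ℝ) (u : E3 → ℂ) : ℝ≥0∞ :=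
  ∑ ν ∈ S.vertices, S.coneNorm k ρ ν (fun x => (φ ν x : ℂ) * u x)

/-- Membership in the weighted Sobolev space `X^k_ρ(∂Ω)`, the closure in `L₂(∂Ω)` of the patchwise
smooth functions of finite norm with respect to the norm of `X^k_ρ(∂Ω)`. -/
def MemX (φ : E3 → E3 → ℝ) (k : ℕ) (ρ : ℝ) (u : E3 → ℂ) : Prop :=
  MemLp u 2 S.surfaceMeasure ∧
    ∃ U : ℕ → E3 → ℂ, (∀ j, S.PwSmooth (U j) ∧ S.normX φ k ρ (U j) < ⊤) ∧
      (∀ ε : ℝ≥0∞, 0 < ε → ∃ J, ∀ j ≥ J, ∀ l ≥ J, S.normX φ k ρ (U j - U l) < ε) ∧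
      Tendsto (fun j => eLpNorm (U j - u) 2 S.surfaceMeasure) atTop (𝓝 0)

end PolyhedralSurface

/-- The function `x ↦ |x - ν|^(-α)`. -/
def pointSingularity (ν : E3) (α : ℝ) (x : E3) : ℂ := ((‖x - ν‖ ^ (-α) : ℝ) : ℂ)

end

open MeasureTheory Filter Topology Set
open scoped ENNReal NNReal ContDiff ComplexConjugate

/-! ### Elementary inequalities -/

lemma one_sub_mul_le_one_add_rpow_neg {x β : ℝ} (hx : 0 ≤ x) (hβ : 0 ≤ β) :
    1 - β * x ≤ (1 + x) ^ (-β) := by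
  rw [Real.rpow_def_of_pos (by linarith)]
  have h1 : Real.log (1 + x) ≤ x := by
    have := Real.log_le_sub_one_of_pos (show 0 < 1 + x by linarith)
    linarith
  have h2 := Real.add_one_le_exp (Real.log (1 + x) * -β)
  nlinarith

/-- Interpolation between the trivial bound and the mean value bound for differences of negative
powers. -/
lemma rpow_neg_sub_rpow_neg_le {a e β τ : ℝ} (ha : 0 < a) (he : 0 ≤ e) (hβ : 0 < β) (hβ2 : β ≤ 2)
    (hτ : 0 ≤ τ) (hτ1 : τ ≤ 1) :
    |a ^ (-β) - (a + e) ^ (-β)| ≤ 2 * (e ^ τ * a ^ (-β - τ)) := by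
  obtain ⟨x, hx, rfl⟩ : ∃ x, 0 ≤ x ∧ e = a * x := ⟨e / a, by positivity, by field_simp⟩
  have h1 : (1 + x) ^ (-β) ≤ 1 :=
    Real.rpow_le_one_of_one_le_of_nonpos (by linarith) (by linarith)
  have h0 : 0 ≤ (1 + x) ^ (-β) := by positivity
  have key : 1 - (1 + x) ^ (-β) ≤ 2 * x ^ τ := by
    rcases le_total 1 x with h | h
    · have := Real.one_le_rpow h hτ
      linarith
    · have h2 := one_sub_mul_le_one_add_rpow_neg hx hβ.le
      have h3 : x ≤ x ^ τ := by
        rcases hx.eq_or_lt with rfl | hx'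
        · positivity
        · simpa using Real.rpow_le_rpow_of_exponent_ge hx' h hτ1
      nlinarith
  have e1 : (a + a * x) ^ (-β) = a ^ (-β) * (1 + x) ^ (-β) := by
    rw [← Real.mul_rpow ha.le (by linarith)]; ring_nf
  have e2 : (a * x) ^ τ * a ^ (-β - τ) = a ^ (-β) * x ^ τ := by
    rw [Real.mul_rpow ha.le hx, mul_right_comm, ← Real.rpow_add ha]
    congr 2; ring
  rw [e1, e2, ← mul_one_sub, abs_of_nonneg (by
    apply mul_nonneg (by positivity); linarith)]
  have : 0 < a ^ (-β) := by positivity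
  nlinarith

/-! ### Kernels on the surface -/

lemma lintegral_ball_edist_rpow_lt_top {β : ℝ} (hβ : β < 2) :
    ∫⁻ y in Metric.ball (0 : ℂ) 1, edist y 0 ^ (-β) < ⊤ := by
  have h : IntegrableOn (fun y : ℂ => ‖y‖ ^ (-β)) (Metric.ball 0 1) := by
    refine (integrableOn_fun_norm_addHaar (E := ℂ) (F := ℝ) volume (f := fun r => r ^ (-β))).2 ?_
    have h2 : IntegrableOn (fun x : ℝ => x ^ (1 - β)) (Ioo 0 1) :=
      (intervalIntegral.integrableOn_Ioo_rpow_iff one_pos).2 (by linarith)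
    refine h2.congr_fun (fun r hr => ?_) measurableSet_Ioo
    simp only [Complex.finrank_real_complex, smul_eq_mul]
    rw [show (1 - β) = ((2 - 1 : ℕ) : ℝ) + (-β) by norm_num; ring, Real.rpow_add hr.1,
      Real.rpow_natCast]
  have h' := h.2
  refine lt_of_le_of_lt (lintegral_mono_ae ?_) h'
  have : ∀ᵐ y : ℂ ∂(volume.restrict (Metric.ball (0 : ℂ) 1)), y ≠ 0 :=
    ae_restrict_of_ae (by simp [ae_iff])
  filter_upwards [this] with y hy
  rw [edist_zero_right, ← ofReal_norm, ← ofReal_norm, Real.norm_of_nonneg (by positivity),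
    ENNReal.ofReal_rpow_of_pos (norm_pos_iff.2 hy)]

lemma lintegral_ball_edist_rpow_eq (x : ℂ) (β : ℝ) :
    ∫⁻ y in Metric.ball x 1, edist y x ^ (-β) = ∫⁻ y in Metric.ball (0 : ℂ) 1, edist y 0 ^ (-β) := by
  rw [← lintegral_indicator measurableSet_ball, ← lintegral_indicator measurableSet_ball,
    ← lintegral_add_right_eq_self _ x]
  congr 1
  ext y
  simp [indicator, edist_eq_enorm_sub]

lemma exists_lintegral_edist_rpow_le {β : ℝ} (hβ0 : 0 ≤ β) (hβ : β < 2) {s : Set ℂ}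
    (hs : volume s < ⊤) :
    ∃ C < (⊤ : ℝ≥0∞), ∀ (f : ℂ →ᵃⁱ[ℝ] E3) (x : E3), ∫⁻ y in s, edist (f y) x ^ (-β) ≤ C := by
  refine ⟨2 ^ β * ((∫⁻ y in Metric.ball (0 : ℂ) 1, edist y 0 ^ (-β)) + volume s), ?_, fun f x => ?_⟩
  · exact ENNReal.mul_lt_top (ENNReal.rpow_lt_top_of_nonneg hβ0 (by simp)) (ENNReal.add_lt_top.2
      ⟨lintegral_ball_edist_rpow_lt_top hβ, hs⟩)
  obtain ⟨z, ⟨y0, rfl⟩, hz⟩ :=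
    (f.isometry.isClosedEmbedding.isClosed_range).exists_infDist_eq_dist (range_nonempty f) x
  have key : ∀ y, edist y y0 ≤ 2 * edist (f y) x := by
    intro y
    have h1 : dist x (f y0) ≤ dist x (f y) := hz ▸ Metric.infDist_le_dist_of_mem ⟨y, rfl⟩
    have h2 : edist x (f y0) ≤ edist (f y) x := by
      rw [edist_dist, edist_dist, dist_comm (f y)]; exact ENNReal.ofReal_le_ofReal h1
    calc edist y y0 = edist (f y) (f y0) := (f.isometry.edist_eq _ _).symm
      _ ≤ edist (f y) x + edist x (f y0) := edist_triangle _ _ _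
      _ ≤ edist (f y) x + edist (f y) x := by gcongr
      _ = _ := (two_mul _).symm
  have key2 : ∀ y, edist (f y) x ^ (-β) ≤ 2 ^ β * edist y y0 ^ (-β) := by
    intro y
    rw [ENNReal.rpow_neg, ENNReal.rpow_neg, ENNReal.inv_le_iff_inv_le,
      ENNReal.mul_inv (by simp) (by simp), inv_inv, ← ENNReal.inv_rpow,
      ← ENNReal.mul_rpow_of_nonneg _ _ hβ0]
    refine ENNReal.rpow_le_rpow ?_ hβ0
    rw [mul_comm, ← div_eq_mul_inv]
    exact ENNReal.div_le_of_le_mul' (key y)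
  have key3 : ∀ y, edist y y0 ^ (-β) ≤
      (Metric.ball y0 1).indicator (fun y => edist y y0 ^ (-β)) y + 1 := by
    intro y
    by_cases hy : y ∈ Metric.ball y0 1
    · simp [hy]
    · rw [indicator_of_notMem hy, zero_add, ENNReal.rpow_neg, ENNReal.inv_le_one]
      have : 1 ≤ edist y y0 := by
        rw [edist_dist, ENNReal.one_le_ofReal]
        simpa using hy
      simpa using ENNReal.rpow_le_rpow this hβ0
  calc ∫⁻ y in s, edist (f y) x ^ (-β) ≤ ∫⁻ y in s, 2 ^ β *
        ((Metric.ball y0 1).indicator (fun y => edist y y0 ^ (-β)) y + 1) :=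
        lintegral_mono fun y => (key2 y).trans (by gcongr; exact key3 y)
    _ = 2 ^ β * ∫⁻ y in s, ((Metric.ball y0 1).indicator (fun y => edist y y0 ^ (-β)) y + 1) :=
        lintegral_const_mul' _ _ (by simp)
    _ = 2 ^ β * ((∫⁻ y in s, (Metric.ball y0 1).indicator (fun y => edist y y0 ^ (-β)) y)
          + volume s) := by
        rw [lintegral_add_right _ measurable_const]; simp
    _ ≤ 2 ^ β * ((∫⁻ y, (Metric.ball y0 1).indicator (fun y => edist y y0 ^ (-β)) y)
          + volume s) := by gcongr; exact Measure.restrict_le_self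
    _ = _ := by rw [lintegral_indicator measurableSet_ball, lintegral_ball_edist_rpow_eq]

lemma isCompact_quad (c : Fin 4 → ℂ) : IsCompact (quad c) := by
  refine IsCompact.union ?_ ?_ <;> exact (Set.toFinite _).isCompact_convexHull (𝕜 := ℝ)

namespace PolyhedralSurface

variable (S : PolyhedralSurface)

lemma volume_flatPatch_lt_top (i : Fin S.numPatches) : volume (S.flatPatch i) < ⊤ :=
  (measure_mono interior_subset).trans_lt (isCompact_quad _).measure_lt_top

lemma measurableEmbedding_chart (i : Fin S.numPatches) : MeasurableEmbedding (S.chart i) :=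
  (S.chart i).isometry.isClosedEmbedding.measurableEmbedding

lemma lintegral_surfaceMeasure (f : E3 → ℝ≥0∞) :
    ∫⁻ x, f x ∂S.surfaceMeasure = ∑ i, ∫⁻ y in S.flatPatch i, f (S.chart i y) := by
  rw [surfaceMeasure, lintegral_finsetSum_measure]
  exact Finset.sum_congr rfl fun i _ => (S.measurableEmbedding_chart i).lintegral_map f

instance : IsFiniteMeasure S.surfaceMeasure := by
  refine ⟨?_⟩
  rw [← lintegral_one, lintegral_surfaceMeasure]
  simp [S.volume_flatPatch_lt_top]

lemma surfaceMeasure_singleton (x : E3) : S.surfaceMeasure {x} = 0 := by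
  rw [← lintegral_indicator_one (measurableSet_singleton x), lintegral_surfaceMeasure]
  refine Finset.sum_eq_zero fun i _ => ?_
  rw [lintegral_eq_zero_iff' (by
    exact ((measurable_one.indicator (measurableSet_singleton x)).comp
      (S.measurableEmbedding_chart i).measurable).aemeasurable)]
  refine ae_restrict_of_ae ?_
  have : (S.chart i ⁻¹' {x}).Subsingleton :=
    subsingleton_singleton.preimage (S.chart i).injective
  filter_upwards [compl_mem_ae_iff.2 (this.measure_zero volume)] with y hy
  exact indicator_of_notMem (s := {x}) hy _

lemma ae_ne (x : E3) : ∀ᵐ y ∂S.surfaceMeasure, y ≠ x :=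
  compl_mem_ae_iff.2 (S.surfaceMeasure_singleton x)

lemma exists_lintegral_surfaceMeasure_edist_rpow_le {β : ℝ} (hβ0 : 0 ≤ β) (hβ : β < 2) :
    ∃ C < (⊤ : ℝ≥0∞), ∀ x : E3, ∫⁻ y, edist y x ^ (-β) ∂S.surfaceMeasure ≤ C := by
  choose C hC h using fun i => exists_lintegral_edist_rpow_le hβ0 hβ (S.volume_flatPatch_lt_top i)
  refine ⟨∑ i, C i, ENNReal.sum_lt_top.2 fun i _ => hC i, fun x => ?_⟩
  rw [lintegral_surfaceMeasure]
  exact Finset.sum_le_sum fun i _ => h i _ x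

lemma exists_eLpNorm_le {lam : ℝ} (h0 : 0 ≤ lam) (h1 : lam < 1) (ν : E3) :
    ∃ C < (⊤ : ℝ≥0∞), ∀ (u : E3 → ℂ) (η : ℝ), 0 ≤ η → (∀ x ≠ ν, ‖u x‖ ≤ η * ‖x - ν‖ ^ (-lam)) →
      eLpNorm u 2 S.surfaceMeasure ≤ ENNReal.ofReal η * C := by
  obtain ⟨C, hC, h⟩ := S.exists_lintegral_surfaceMeasure_edist_rpow_le (β := 2 * lam)
    (by linarith) (by linarith)
  refine ⟨C ^ (1 / 2 : ℝ), ENNReal.rpow_lt_top_of_nonneg (by norm_num) hC.ne, fun u η hη hu => ?_⟩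
  have : eLpNorm u 2 S.surfaceMeasure ≤
      eLpNorm (fun x => ENNReal.ofReal η * edist x ν ^ (-lam)) 2 S.surfaceMeasure := by
    refine eLpNorm_mono_enorm_ae ?_
    filter_upwards [S.ae_ne ν] with x hx
    have h2 : 0 < ‖x - ν‖ := norm_pos_iff.2 (sub_ne_zero.2 hx)
    rw [← ofReal_norm, enorm_eq_self, edist_dist, dist_eq_norm,
      ENNReal.ofReal_rpow_of_pos h2, ← ENNReal.ofReal_mul hη]
    exact ENNReal.ofReal_le_ofReal (hu x hx)
  refine this.trans ?_
  rw [eLpNorm_eq_lintegral_rpow_enorm_toReal (by norm_num) (by norm_num)]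
  simp only [ENNReal.toReal_ofNat, enorm_eq_self]
  have h3 : ∀ x, (ENNReal.ofReal η * edist x ν ^ (-lam)) ^ (2 : ℝ) =
      ENNReal.ofReal η ^ (2 : ℝ) * edist x ν ^ (-(2 * lam)) := by
    intro x
    rw [ENNReal.mul_rpow_of_nonneg _ _ (by norm_num), ← ENNReal.rpow_mul]
    congr 2; ring
  simp only [h3]
  rw [lintegral_const_mul' _ _ (by simp), ENNReal.mul_rpow_of_nonneg _ _ (by norm_num),
    ← ENNReal.rpow_mul]
  norm_num
  gcongr
  exact h ν

lemma measurable_pointSingularity (ν : E3) (α : ℝ) : Measurable (pointSingularity ν α) := by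
  unfold pointSingularity
  fun_prop

lemma memLp_pointSingularity (ν : E3) {α : ℝ} (h0 : 0 ≤ α) (h1 : α < 1) :
    MemLp (pointSingularity ν α) 2 S.surfaceMeasure := by
  obtain ⟨C, hC, h⟩ := S.exists_eLpNorm_le h0 h1 ν
  refine ⟨(measurable_pointSingularity ν α).aestronglyMeasurable,
    (h _ 1 zero_le_one fun x hx => ?_).trans_lt (by simpa using hC)⟩
  simp [pointSingularity, abs_of_nonneg (Real.rpow_nonneg (norm_nonneg (x - ν)) _)]

lemma enorm_pointSingularity_sub_le {ν x y : E3} (hx : x ≠ ν) (hy : y ≠ ν) {α τ : ℝ} (h0 : 0 < α)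
    (h2 : α ≤ 2) (hτ : 0 ≤ τ) (hτ1 : τ ≤ 1) :
    ‖pointSingularity ν α x - pointSingularity ν α y‖ₑ ≤
      2 * (edist x y ^ τ * (edist x ν ^ (-(α + τ)) + edist y ν ^ (-(α + τ)))) := by
  wlog hxy : ‖x - ν‖ ≤ ‖y - ν‖ generalizing x y
  · have := this hy hx (le_of_not_ge hxy)
    rwa [enorm_sub_rev, edist_comm, add_comm] at this
  have hx0 : 0 < ‖x - ν‖ := norm_pos_iff.2 (sub_ne_zero.2 hx)
  have h3 := rpow_neg_sub_rpow_neg_le (e := ‖y - ν‖ - ‖x - ν‖) hx0 (by linarith) h0 h2 hτ hτ1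
  rw [add_sub_cancel] at h3
  have h4 : ‖y - ν‖ - ‖x - ν‖ ≤ dist x y := by
    have := norm_sub_norm_le (y - ν) (x - ν)
    rwa [sub_sub_sub_cancel_right, ← dist_eq_norm y x, dist_comm] at this
  calc ‖pointSingularity ν α x - pointSingularity ν α y‖ₑ
      ≤ ENNReal.ofReal (2 * (dist x y ^ τ * ‖x - ν‖ ^ (-(α + τ)))) := by
        rw [← ofReal_norm]
        refine ENNReal.ofReal_le_ofReal ?_
        rw [pointSingularity, pointSingularity, ← Complex.ofReal_sub, Complex.norm_real,
          Real.norm_eq_abs]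
        refine h3.trans ?_
        rw [show -(α + τ) = -α - τ by ring]
        gcongr
    _ = 2 * (edist x y ^ τ * edist x ν ^ (-(α + τ))) := by
        rw [ENNReal.ofReal_mul (by norm_num), ENNReal.ofReal_mul (by positivity), edist_dist,
          edist_dist, dist_eq_norm x ν, ENNReal.ofReal_rpow_of_pos hx0,
          ENNReal.ofReal_rpow_of_nonneg dist_nonneg hτ]
        simp
    _ ≤ _ := by gcongr; exact le_self_add

lemma slobodeckij_pointSingularity_lt_top (ν : E3) {α s : ℝ} (h0 : 0 < α) (hs : 0 < s)
    (hs1 : s < 1 - α) : slobodeckij S.surfaceMeasure s (pointSingularity ν α) < ⊤ := by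
  obtain ⟨τ, hτ, hτ1⟩ := exists_between hs1
  obtain ⟨C, hC, h⟩ := S.exists_lintegral_surfaceMeasure_edist_rpow_le (β := 2 * (α + τ))
    (by linarith) (by linarith)
  obtain ⟨D, hD, h'⟩ := S.exists_lintegral_surfaceMeasure_edist_rpow_le (β := 2 + 2 * s - 2 * τ)
    (by linarith) (by linarith)
  set μ := S.surfaceMeasure
  set p : E3 → ℝ≥0∞ := fun x => edist x ν ^ (-(2 * (α + τ))) with hp
  set k : E3 → E3 → ℝ≥0∞ := fun x y => edist y x ^ (-(2 + 2 * s - 2 * τ)) with hk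
  have hpm : Measurable p := by fun_prop
  have hkm : Measurable (fun z : E3 × E3 => k z.1 z.2) := by fun_prop
  have hkx : ∀ x, Measurable (k x) := fun x => by fun_prop
  have bound : ∀ x ≠ ν, ∀ y ≠ ν,
      ‖pointSingularity ν α x - pointSingularity ν α y‖ₑ ^ 2 / edist x y ^ (2 + 2 * s) ≤
        8 * (p x * k x y + p y * k x y) := by
    intro x hx y hy
    rcases eq_or_ne x y with rfl | hxy
    · simp
    have hd0 : edist x y ≠ 0 := by simpa [edist_eq_zero] using hxy
    have h1 := enorm_pointSingularity_sub_le hx hy (τ := τ) h0 (by linarith) (by linarith)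
      (by linarith)
    have e1 : ∀ z : E3, (edist z ν ^ (-(α + τ))) ^ 2 = p z := fun z => by
      rw [hp, ← ENNReal.rpow_natCast, ← ENNReal.rpow_mul]; congr 1; push_cast; ring
    have e2 : (edist x y ^ τ) ^ 2 / edist x y ^ (2 + 2 * s) = k x y := by
      rw [hk, ← ENNReal.rpow_natCast, ← ENNReal.rpow_mul, ← ENNReal.rpow_sub _ _ hd0
        (edist_ne_top _ _), edist_comm]
      congr 1; push_cast; ring
    have e3 : ∀ a b : ℝ≥0∞, (a + b) ^ 2 ≤ 2 * (a ^ 2 + b ^ 2) := fun a b => by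
      have := ENNReal.rpow_add_le_mul_rpow_add_rpow a b (p := 2) (by norm_num)
      norm_num at this
      exact_mod_cast this
    calc _ ≤ (2 * (edist x y ^ τ * (edist x ν ^ (-(α + τ)) + edist y ν ^ (-(α + τ))))) ^ 2
          / edist x y ^ (2 + 2 * s) := by gcongr
      _ = 4 * ((edist x ν ^ (-(α + τ)) + edist y ν ^ (-(α + τ))) ^ 2) * k x y := by
        rw [← e2, div_eq_mul_inv, div_eq_mul_inv]; ring
      _ ≤ 4 * (2 * (p x + p y)) * k x y := by
        gcongr
        rw [← e1, ← e1]
        exact e3 _ _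
      _ = _ := by ring
  have hk1 : ∀ x, ∫⁻ y, k x y ∂μ ≤ D := h'
  have hk2 : ∀ y, ∫⁻ x, k x y ∂μ ≤ D := fun y => by
    simp only [hk, edist_comm y]; exact h' y
  have i1 : ∫⁻ x, ∫⁻ y, p x * k x y ∂μ ∂μ ≤ C * D := by
    calc _ ≤ ∫⁻ x, p x * D ∂μ := lintegral_mono fun x => by
          rw [lintegral_const_mul _ (hkx x)]; gcongr; exact hk1 x
      _ ≤ _ := by rw [lintegral_mul_const _ hpm]; gcongr; exact h ν
  have i2 : ∫⁻ x, ∫⁻ y, p y * k x y ∂μ ∂μ ≤ C * D := by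
    rw [lintegral_lintegral_swap (by fun_prop)]
    calc _ ≤ ∫⁻ x, p x * D ∂μ := lintegral_mono fun x => by
          rw [lintegral_const_mul _ (by fun_prop)]; gcongr; exact hk2 x
      _ ≤ _ := by rw [lintegral_mul_const _ hpm]; gcongr; exact h ν
  calc slobodeckij μ s (pointSingularity ν α)
      ≤ ∫⁻ x, ∫⁻ y, 8 * (p x * k x y + p y * k x y) ∂μ ∂μ := by
        refine lintegral_mono_ae ?_
        filter_upwards [S.ae_ne ν] with x hx
        refine lintegral_mono_ae ?_
        filter_upwards [S.ae_ne ν] with y hy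
        exact bound x hx y hy
    _ = 8 * (∫⁻ x, ∫⁻ y, p x * k x y ∂μ ∂μ + ∫⁻ x, ∫⁻ y, p y * k x y ∂μ ∂μ) := by
        rw [← lintegral_add_left (by
          exact Measurable.lintegral_prod_right' (f := fun z : E3 × E3 => p z.1 * k z.1 z.2)
            (by fun_prop)), ← lintegral_const_mul' _ _ (by norm_num)]
        refine lintegral_congr fun x => ?_
        rw [lintegral_const_mul' _ _ (by norm_num), lintegral_add_left (by fun_prop)]
    _ ≤ 8 * (C * D + C * D) := by gcongr
    _ < ⊤ := by
        refine ENNReal.mul_lt_top (by norm_num) (ENNReal.add_lt_top.2 ⟨?_, ?_⟩) <;>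
        exact ENNReal.mul_lt_top hC hD

end PolyhedralSurface

/-! ### Cones inside quadrilaterals -/

lemma affineSpan_triangle_eq_top {a b d : ℂ} (h : 0 < (conj (b - a) * (d - a)).im) :
    affineSpan ℝ ({a, b, d} : Set ℂ) = ⊤ := by
  rw [AffineSubspace.affineSpan_eq_top_iff_vectorSpan_eq_top_of_nonempty ℝ ℂ ℂ ⟨a, by simp⟩,
    eq_top_iff]
  intro z _
  have hb : b - a ∈ vectorSpan ℝ ({a, b, d} : Set ℂ) :=
    vsub_mem_vectorSpan ℝ (by simp) (by simp)
  have hd : d - a ∈ vectorSpan ℝ ({a, b, d} : Set ℂ) :=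
    vsub_mem_vectorSpan ℝ (by simp) (by simp)
  generalize b - a = p at *
  generalize d - a = q at *
  have : z = ((conj z * q).im / (conj p * q).im) • p + ((conj p * z).im / (conj p * q).im) • q := by
    have h' := h.ne'
    simp only [Complex.mul_im, Complex.conj_re, Complex.conj_im] at h' ⊢
    apply Complex.ext
    · simp only [Complex.add_re, Complex.real_smul, Complex.mul_re, Complex.ofReal_re,
        Complex.ofReal_im]
      rw [zero_mul, zero_mul, sub_zero, sub_zero, div_mul_eq_mul_div, div_mul_eq_mul_div,
        ← add_div, eq_div_iff h']
      ring
    · simp only [Complex.add_im, Complex.real_smul, Complex.mul_im, Complex.ofReal_re,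
        Complex.ofReal_im]
      rw [zero_mul, zero_mul, add_zero, add_zero, div_mul_eq_mul_div, div_mul_eq_mul_div,
        ← add_div, eq_div_iff h']
      ring
  rw [this]
  exact add_mem (Submodule.smul_mem _ _ hb) (Submodule.smul_mem _ _ hd)

lemma exists_cone_subset_of_convex {T : Set ℂ} (hT : Convex ℝ T) (hne : (interior T).Nonempty)
    {c : ℂ} (hc : c ∈ T) :
    ∃ (w : ℂ) (δ : ℝ), 0 < δ ∧ δ ≤ ‖w‖ ∧
      ∀ t : ℝ, 0 < t → t ≤ 1 → Metric.ball (c + t • w) (t * δ) ⊆ interior T := by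
  obtain ⟨p, hp, hpc⟩ : ∃ p ∈ interior T, p ≠ c := by
    obtain ⟨p, hp⟩ := hne
    by_contra! h
    have h1 : interior T = {c} := subset_antisymm (fun q hq => h q hq) (by
      rw [singleton_subset_iff, ← h p hp]; exact hp)
    exact not_isOpen_singleton c (h1 ▸ isOpen_interior)
  obtain ⟨ε, hε, hb⟩ := Metric.isOpen_iff.1 isOpen_interior p hp
  have hpos : 0 < ‖p - c‖ := norm_pos_iff.2 (sub_ne_zero.2 hpc)
  refine ⟨p - c, min ε ‖p - c‖, lt_min hε hpos, min_le_right _ _, fun t ht ht1 => ?_⟩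
  refine interior_maximal (fun y hy => ?_) Metric.isOpen_ball
  have h1 : c + t⁻¹ • (y - c) ∈ T := by
    refine interior_subset (hb ?_)
    rw [Metric.mem_ball, dist_eq_norm] at hy ⊢
    have e : c + t⁻¹ • (y - c) - p = t⁻¹ • (y - (c + t • (p - c))) := by
      rw [smul_sub, smul_sub, smul_add, inv_smul_smul₀ ht.ne']; abel
    rw [e, norm_smul, norm_inv, Real.norm_of_nonneg ht.le, inv_mul_lt_iff₀ ht]
    exact hy.trans_le (by gcongr; exact min_le_left _ _)
  have h2 := hT hc h1 (sub_nonneg.2 ht1) ht.le (by ring)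
  convert h2 using 1
  rw [smul_add, smul_inv_smul₀ ht.ne', sub_smul, one_smul]
  abel

lemma exists_cone_subset_interior_quad {c : Fin 4 → ℂ} (h : IsQuad c) (k : Fin 4) :
    ∃ (w : ℂ) (δ : ℝ), 0 < δ ∧ δ ≤ ‖w‖ ∧
      ∀ t : ℝ, 0 < t → t ≤ 1 → Metric.ball (c k + t • w) (t * δ) ⊆ interior (quad c) := by
  have key : ∀ T ⊆ quad c, Convex ℝ T → (interior T).Nonempty → c k ∈ T →
      ∃ (w : ℂ) (δ : ℝ), 0 < δ ∧ δ ≤ ‖w‖ ∧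
      ∀ t : ℝ, 0 < t → t ≤ 1 → Metric.ball (c k + t • w) (t * δ) ⊆ interior (quad c) := by
    intro T hTq hT hne hc
    obtain ⟨w, δ, h1, h2, h3⟩ := exists_cone_subset_of_convex hT hne hc
    exact ⟨w, δ, h1, h2, fun t ht ht1 => (h3 t ht ht1).trans (interior_mono hTq)⟩
  have i1 := interior_convexHull_nonempty_iff_affineSpan_eq_top.2 (affineSpan_triangle_eq_top h.1)
  have i2 := interior_convexHull_nonempty_iff_affineSpan_eq_top.2 (affineSpan_triangle_eq_top h.2)
  by_cases hk : k = 3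
  · exact key _ subset_union_right (convex_convexHull ℝ _) i2
      (subset_convexHull ℝ _ (by simp [hk]))
  · refine key _ subset_union_left (convex_convexHull ℝ _) i1 (subset_convexHull ℝ _ ?_)
    fin_cases k <;> simp at hk ⊢

/-! ### Failure of fractional smoothness at the critical order -/

lemma slobodeckij_rpow_norm_eq_top {P : Set ℂ} {c w : ℂ} {δ α s : ℝ} (hδ : 0 < δ) (hδw : δ ≤ ‖w‖)
    (hP : ∀ t : ℝ, 0 < t → t ≤ 1 → Metric.ball (c + t • w) (t * δ) ⊆ P) (hα : 0 < α)
    (hs : 1 - α ≤ s) (hs0 : 0 ≤ s) :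
    slobodeckij (volume.restrict P) s (fun y => ((‖y - c‖ ^ (-α) : ℝ) : ℂ)) = ⊤ := by
  by_contra hfin
  set G : ℂ → ℝ≥0∞ := fun y => ∫⁻ z in P,
    ‖((‖y - c‖ ^ (-α) : ℝ) : ℂ) - ((‖z - c‖ ^ (-α) : ℝ) : ℂ)‖ₑ ^ 2 / edist y z ^ (2 + 2 * s) with hG
  have hGfin : ∫⁻ y in P, G y ≠ ⊤ := hfin
  have hw : 0 < ‖w‖ := hδ.trans_le hδw
  set w' : ℂ := (1 + δ / (2 * ‖w‖)) • w with hw'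
  have nw' : ‖w'‖ = ‖w‖ + δ / 2 := by
    rw [hw', norm_smul, Real.norm_of_nonneg (by positivity)]
    field_simp
  have dw' : ‖w' - w‖ = δ / 2 := by
    have : w' - w = (δ / (2 * ‖w‖)) • w := by rw [hw', add_smul, one_smul]; abel
    rw [this, norm_smul, Real.norm_of_nonneg (by positivity)]
    field_simp
  set a := ‖w‖ + δ / 8
  set b := ‖w‖ + 3 * δ / 8
  have ha : 0 < a := by positivity
  have hab : a < b := by simp only [a, b]; linarith
  set A := a ^ (-α) - b ^ (-α)
  have hA : 0 < A := sub_pos.2 (Real.rpow_lt_rpow_of_neg ha hab (by linarith))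
  set D := a + (‖w‖ + 5 * δ / 8)
  have hD : 0 < D := by positivity
  set B : ℝ → Set ℂ := fun t => Metric.ball (c + t • w) (t * (δ / 8))
  set B' : ℝ → Set ℂ := fun t => Metric.ball (c + t • w') (t * (δ / 8))
  have hBP : ∀ t, 0 < t → t ≤ 1 → B t ⊆ P := fun t ht ht1 =>
    (Metric.ball_subset_ball (by gcongr; linarith)).trans (hP t ht ht1)
  have hBP' : ∀ t, 0 < t → t ≤ 1 → B' t ⊆ P := fun t ht ht1 => by
    refine (Metric.ball_subset_ball' ?_).trans (hP t ht ht1)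
    rw [dist_add_left, dist_eq_norm, ← smul_sub, norm_smul, dw', Real.norm_of_nonneg ht.le]
    nlinarith
  have nB : ∀ t, 0 < t → ∀ y ∈ B t, 0 < ‖y - c‖ ∧ ‖y - c‖ ≤ t * a := fun t ht y hy => by
    rw [Metric.mem_ball, dist_eq_norm] at hy
    have e : y - c = t • w + (y - (c + t • w)) := by abel
    have e' : t • w = (y - c) - (y - (c + t • w)) := by abel
    have n1 := norm_add_le (t • w) (y - (c + t • w))
    have n2 := norm_sub_le (y - c) (y - (c + t • w))
    rw [← e, norm_smul, Real.norm_of_nonneg ht.le] at n1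
    rw [← e', norm_smul, Real.norm_of_nonneg ht.le] at n2
    exact ⟨by nlinarith, by change _ ≤ t * (‖w‖ + δ / 8); nlinarith⟩
  have nB' : ∀ t, 0 < t → ∀ y ∈ B' t, t * b ≤ ‖y - c‖ ∧ ‖y - c‖ ≤ t * (‖w‖ + 5 * δ / 8) :=
    fun t ht y hy => by
    rw [Metric.mem_ball, dist_eq_norm] at hy
    have e : y - c = t • w' + (y - (c + t • w')) := by abel
    have e' : t • w' = (y - c) - (y - (c + t • w')) := by abel
    have n1 := norm_add_le (t • w') (y - (c + t • w'))
    have n2 := norm_sub_le (y - c) (y - (c + t • w'))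
    rw [← e, norm_smul, Real.norm_of_nonneg ht.le, nw'] at n1
    rw [← e', norm_smul, Real.norm_of_nonneg ht.le, nw'] at n2
    exact ⟨by change t * (‖w‖ + 3 * δ / 8) ≤ _; nlinarith, by nlinarith⟩
  set K : ℝ → ℝ := fun t => (t ^ (-α) * A) ^ 2 / (t * D) ^ (2 + 2 * s)
  have lower : ∀ t, 0 < t → ∀ y ∈ B t, ∀ z ∈ B' t, ENNReal.ofReal (K t) ≤
      ‖((‖y - c‖ ^ (-α) : ℝ) : ℂ) - ((‖z - c‖ ^ (-α) : ℝ) : ℂ)‖ₑ ^ 2 / edist y z ^ (2 + 2 * s) := by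
    intro t ht y hy z hz
    obtain ⟨y0, y1⟩ := nB t ht y hy
    obtain ⟨z0, z1⟩ := nB' t ht z hz
    have h1 : t ^ (-α) * A ≤ ‖y - c‖ ^ (-α) - ‖z - c‖ ^ (-α) := by
      have h2 := Real.rpow_le_rpow_of_nonpos y0 y1 (show -α ≤ 0 by linarith)
      have h3 := Real.rpow_le_rpow_of_nonpos (show 0 < t * b by positivity) z0
        (show -α ≤ 0 by linarith)
      rw [Real.mul_rpow ht.le (by positivity)] at h2 h3
      simp only [A, mul_sub]
      linarith
    have h2 : dist y z ≤ t * D := by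
      have h3 := dist_triangle_right y z c
      rw [dist_eq_norm y c, dist_eq_norm z c] at h3
      calc dist y z ≤ t * a + t * (‖w‖ + 5 * δ / 8) := by linarith
        _ = t * D := (mul_add _ _ _).symm
    rw [ENNReal.ofReal_div_of_pos (by positivity), ← ENNReal.ofReal_rpow_of_pos (by positivity),
      ENNReal.ofReal_pow (by positivity), ← Complex.ofReal_sub, ← ofReal_norm, edist_dist,
      Complex.norm_real, Real.norm_of_nonneg (le_trans (by positivity) h1)]
    gcongr
  have hBm : ∀ t, MeasurableSet (B t) := fun t => measurableSet_ball
  set K0 := A ^ 2 / D ^ (2 + 2 * s) * ((δ / 8) ^ 2 * Real.pi) ^ 2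
  have hK0 : 0 < K0 := by positivity
  have vol : ∀ (x : ℂ) (t : ℝ), 0 < t → volume (Metric.ball x (t * (δ / 8))) =
      ENNReal.ofReal (t ^ 2 * ((δ / 8) ^ 2 * Real.pi)) := fun x t ht => by
    rw [Complex.volume_ball, ← ENNReal.ofReal_pow (by positivity), ← mul_assoc, ← mul_pow,
      ENNReal.ofReal_mul (by positivity)]
    congr 1
    rw [ENNReal.ofReal, Real.toNNReal_of_nonneg Real.pi_pos.le]
    rfl
  have main : ∀ t, 0 < t → t ≤ 1 → ENNReal.ofReal K0 ≤ ∫⁻ y in B t, G y ∂(volume.restrict P) := by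
    intro t ht ht1
    calc ENNReal.ofReal K0 ≤ ENNReal.ofReal (K t * (t ^ 2 * ((δ / 8) ^ 2 * Real.pi)) *
          (t ^ 2 * ((δ / 8) ^ 2 * Real.pi))) := by
          refine ENNReal.ofReal_le_ofReal ?_
          have e : K t * (t ^ 2 * ((δ / 8) ^ 2 * Real.pi)) * (t ^ 2 * ((δ / 8) ^ 2 * Real.pi)) =
              K0 * t ^ (2 - 2 * α - 2 * s) := by
            have e1 : t ^ (2 - 2 * α - 2 * s) =
                (t ^ (-α)) ^ 2 * t ^ 4 / t ^ (2 + 2 * s) := by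
              rw [← Real.rpow_natCast, ← Real.rpow_natCast, ← Real.rpow_mul ht.le,
                ← Real.rpow_add ht, ← Real.rpow_sub ht]
              congr 1; push_cast; ring
            simp only [K, K0]
            rw [e1, Real.mul_rpow ht.le hD.le]
            field_simp
          rw [e]
          exact le_mul_of_one_le_right hK0.le
            (Real.one_le_rpow_of_pos_of_le_one_of_nonpos ht ht1 (by linarith))
      _ = ENNReal.ofReal (K t) * volume (B' t) * volume (B t) := by
          rw [vol _ t ht, vol _ t ht, ENNReal.ofReal_mul (by positivity),
            ENNReal.ofReal_mul (by positivity)]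
      _ = ∫⁻ y in B t, ENNReal.ofReal (K t) * volume (B' t) := by simp
      _ ≤ ∫⁻ y in B t, G y := by
          refine setLIntegral_mono' (hBm t) fun y hy => ?_
          calc _ = ∫⁻ z in B' t, ENNReal.ofReal (K t) := by simp
            _ ≤ _ := setLIntegral_mono' measurableSet_ball fun z hz => lower t ht y hy z hz
            _ ≤ _ := lintegral_mono_set (hBP' t ht ht1)
      _ = _ := by
          rw [Measure.restrict_restrict (hBm t), inter_eq_left.2 (hBP t ht ht1)]
  have hvol0 : Tendsto (fun t => volume.restrict P (B t)) (𝓝[>] 0) (𝓝 0) := by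
    have h1 : Tendsto (fun t : ℝ => ENNReal.ofReal (t ^ 2 * ((δ / 8) ^ 2 * Real.pi))) (𝓝[>] 0)
        (𝓝 0) := by
      have : Tendsto (fun t : ℝ => ENNReal.ofReal (t ^ 2 * ((δ / 8) ^ 2 * Real.pi))) (𝓝 0)
          (𝓝 (ENNReal.ofReal (0 ^ 2 * ((δ / 8) ^ 2 * Real.pi)))) :=
        (ENNReal.continuous_ofReal.comp (by fun_prop)).tendsto 0
      simpa using this.mono_left nhdsWithin_le_nhds
    refine tendsto_of_tendsto_of_tendsto_of_le_of_le' tendsto_const_nhds h1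
      (Eventually.of_forall fun _ => zero_le) ?_
    filter_upwards [self_mem_nhdsWithin] with t ht
    exact (Measure.restrict_apply_le _ _).trans (vol _ t ht).le
  have hlim := tendsto_setLIntegral_zero hGfin hvol0
  have := ge_of_tendsto hlim (by
    filter_upwards [Ioc_mem_nhdsGT (zero_lt_one' ℝ)] with t ht
    exact main t ht.1 ht.2)
  simp [hK0.not_ge] at this

namespace PolyhedralSurface

variable (S : PolyhedralSurface)

lemma le_slobodeckij_surfaceMeasure (s : ℝ) (u : E3 → ℂ) (i : Fin S.numPatches) :
    slobodeckij (volume.restrict (S.flatPatch i)) s (fun y => u (S.chart i y)) ≤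
      slobodeckij S.surfaceMeasure s u := by
  have h : ∀ f : E3 → ℝ≥0∞, ∫⁻ y in S.flatPatch i, f (S.chart i y) ≤
      ∫⁻ x, f x ∂S.surfaceMeasure := fun f => by
    rw [lintegral_surfaceMeasure]
    exact Finset.single_le_sum (f := fun i => ∫⁻ y in S.flatPatch i, f (S.chart i y))
      (fun _ _ => zero_le) (Finset.mem_univ i)
  refine le_trans (lintegral_mono fun y => ?_) (h _)
  refine le_trans (le_of_eq ?_) (h _)
  simp only [(S.chart i).isometry.edist_eq]

lemma pointSingularity_chart {p : Fin S.numPatches × Fin 4} {ν : E3} (hp : S.cornerPoint p = ν)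
    (α : ℝ) (y : ℂ) : pointSingularity ν α (S.chart p.1 y) =
      ((‖y - S.corner p.1 p.2‖ ^ (-α) : ℝ) : ℂ) := by
  rw [pointSingularity, ← hp, cornerPoint, ← dist_eq_norm, (S.chart p.1).isometry.dist_eq,
    dist_eq_norm]

end PolyhedralSurface

/-! ### Failure of first order smoothness -/

lemma integrable_mul_of_tsupport_subset {f k : ℂ → ℝ} (hf : Continuous f)
    (hc : HasCompactSupport f) (h0 : tsupport f ⊆ {0}ᶜ) (hk : ContinuousOn k {0}ᶜ) :
    Integrable (fun z => f z * k z) := by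
  refine Continuous.integrable_of_hasCompactSupport ?_ hc.mul_right
  refine continuous_of_tsupport fun z hz => ?_
  have hz' := tsupport_mul_subset_left hz
  exact hf.continuousAt.mul (hk.continuousAt (isOpen_compl_singleton.mem_nhds (h0 hz')))

lemma hasFDerivAt_norm_rpow_of_ne_zero {z : ℂ} (hz : z ≠ 0) (p : ℝ) :
    HasFDerivAt (fun y : ℂ => ‖y‖ ^ p) ((p * ‖z‖ ^ (p - 2)) • innerSL ℝ z) z := by
  have hz' : 0 < ‖z‖ := norm_pos_iff.2 hz
  have h := ((hasStrictFDerivAt_norm_sq z).hasFDerivAt).rpow_const (p := p / 2)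
    (Or.inl (by positivity))
  have e : ∀ y : ℂ, (‖y‖ ^ 2) ^ (p / 2) = ‖y‖ ^ p := fun y => by
    rw [← Real.rpow_natCast, ← Real.rpow_mul (norm_nonneg _)]; congr 1; push_cast; ring
  simp only [e] at h
  suffices e2 : (p / 2 * (‖z‖ ^ 2) ^ (p / 2 - 1)) • 2 • innerSL ℝ z =
      (p * ‖z‖ ^ (p - 2)) • innerSL ℝ z by rwa [e2] at h
  rw [← Real.rpow_natCast, ← Real.rpow_mul (norm_nonneg _), ← Nat.cast_smul_eq_nsmul ℝ, smul_smul]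
  congr 1
  rw [show ((2 : ℕ) : ℝ) * (p / 2 - 1) = p - 2 by push_cast; ring]
  push_cast; ring

lemma exists_integral_fderiv_mul_norm_rpow_ne_zero {w : ℂ} {δ α : ℝ} (hδ : 0 < δ) (hδw : δ ≤ ‖w‖)
    (hα : 0 < α) : ∃ ψ : ℂ → ℝ, ContDiff ℝ ∞ ψ ∧ HasCompactSupport ψ ∧
      tsupport ψ ⊆ Metric.ball w δ ∧
      ((∫ z, fderiv ℝ ψ z 1 * ‖z‖ ^ (-α) ≠ 0) ∨
        ∫ z, fderiv ℝ ψ z Complex.I * ‖z‖ ^ (-α) ≠ 0) := by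
  let ψ : ContDiffBump w := ⟨δ / 4, δ / 2, by positivity, by linarith⟩
  have hsub : tsupport ψ ⊆ Metric.ball w δ := by
    rw [ψ.tsupport_eq]
    exact Metric.closedBall_subset_ball (by change δ / 2 < δ; linarith)
  refine ⟨ψ, ψ.contDiff, ψ.hasCompactSupport, hsub, ?_⟩
  have h0 : tsupport ψ ⊆ {0}ᶜ := fun z hz => by
    have := hsub hz
    rintro rfl
    rw [Metric.mem_ball, dist_zero_left] at this
    linarith
  have hg : ∀ p : ℝ, ContinuousOn (fun z : ℂ => ‖z‖ ^ p) {0}ᶜ := fun p z hz =>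
    (hasFDerivAt_norm_rpow_of_ne_zero hz p).continuousAt.continuousWithinAt
  have hcd : ContDiff ℝ ∞ ψ := ψ.contDiff
  have hψd : Differentiable ℝ ψ := hcd.differentiable (by simp)
  have hcf : ∀ v, Continuous (fun z => fderiv ℝ ψ z v) := fun v =>
    (hcd.continuous_fderiv (by simp)).clm_apply continuous_const
  have hsf : ∀ v, tsupport (fun z => fderiv ℝ ψ z v) ⊆ tsupport ψ := fun v =>
    tsupport_fderiv_apply_subset ℝ v
  have hif : ∀ v, Integrable (fun z => fderiv ℝ ψ z v * ‖z‖ ^ (-α)) := fun v =>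
    integrable_mul_of_tsupport_subset (hcf v)
      (ψ.hasCompactSupport.mono' (subset_tsupport _ |>.trans (hsf v))) ((hsf v).trans h0) (hg _)
  set k : ℂ → ℝ := fun z => -α * ‖z‖ ^ (-α - 2) * inner ℝ z w with hk
  have hkc : ContinuousOn k {0}ᶜ := by
    refine ContinuousOn.mul (ContinuousOn.mul continuousOn_const (hg _)) ?_
    fun_prop
  have hik : Integrable (fun z => ψ z * k z) :=
    integrable_mul_of_tsupport_subset ψ.continuous ψ.hasCompactSupport h0 hkc
  have hkd : ∀ z, ψ z * fderiv ℝ (fun y : ℂ => ‖y‖ ^ (-α)) z w = ψ z * k z := fun z => by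
    by_cases hz : ψ z = 0
    · simp [hz]
    · rw [(hasFDerivAt_norm_rpow_of_ne_zero (h0 (subset_tsupport _ hz)) (-α)).fderiv]
      simp [hk]
  have parts := integral_mul_fderiv_eq_neg_fderiv_mul_of_integrable (μ := volume) (f := ψ)
    (g := fun y : ℂ => ‖y‖ ^ (-α)) (v := w) (hif w) (by simpa only [hkd] using hik)
    (integrable_mul_of_tsupport_subset ψ.continuous ψ.hasCompactSupport h0 (hg _))
    (fun z _ => hψd z) (fun z hz => (hasFDerivAt_norm_rpow_of_ne_zero (h0 hz) _).differentiableAt)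
  simp only [hkd] at parts
  have hpos : ∀ z, ψ z ≠ 0 → k z < 0 := fun z hz => by
    have h1 := hsub (subset_tsupport _ hz)
    rw [Metric.mem_ball, dist_eq_norm] at h1
    have h2 : 0 < ‖z‖ := norm_pos_iff.2 (h0 (subset_tsupport _ hz))
    have h3 : 0 < inner ℝ z w := by
      have h4 : inner ℝ z w = inner ℝ (z - w) w + ‖w‖ ^ 2 := by
        rw [inner_sub_left, real_inner_self_eq_norm_sq]; ring
      have h5 := abs_real_inner_le_norm (z - w) w
      have h6 := neg_abs_le (inner ℝ (z - w) w)
      nlinarith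
    have : 0 < α * ‖z‖ ^ (-α - 2) * inner ℝ z w := by positivity
    simp only [hk]; linarith
  have hneg : 0 < ∫ z, -(ψ z * k z) := by
    rw [integral_pos_iff_support_of_nonneg (f := fun z => -(ψ z * k z)) _ hik.neg]
    · refine (Metric.measure_ball_pos volume w (half_pos hδ)).trans_le (measure_mono ?_)
      · intro z hz
        have h1 : ψ z ≠ 0 := by
          have : z ∈ Function.support ψ := by rw [ψ.support_eq]; exact hz
          exact this
        simpa using ⟨h1, (hpos z h1).ne⟩
    · intro z
      by_cases hz : ψ z = 0
      · simp [hz]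
      · have := mul_nonpos_of_nonneg_of_nonpos (ψ.nonneg' z) (hpos z hz).le
        simp only [Pi.zero_apply]
        linarith
  rw [integral_neg, parts, neg_neg] at hneg
  by_contra! hcon
  have e : ∀ z, fderiv ℝ ψ z w * ‖z‖ ^ (-α) = w.re * (fderiv ℝ ψ z 1 * ‖z‖ ^ (-α)) +
      w.im * (fderiv ℝ ψ z Complex.I * ‖z‖ ^ (-α)) := fun z => by
    have h1 : fderiv ℝ ψ z w = fderiv ℝ ψ z (w.re • (1 : ℂ) + w.im • Complex.I) := by
      congr 1
      simp [Complex.re_add_im]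
    rw [h1, map_add, map_smul, map_smul]
    simp only [smul_eq_mul]; ring
  simp only [e] at hneg
  rw [integral_add ((hif 1).const_mul _) ((hif _).const_mul _), integral_const_mul,
    integral_const_mul, hcon.1, hcon.2] at hneg
  simp at hneg

lemma integral_fderiv_mul_norm_rpow_eq_zero {P : Set ℂ} {c w e : ℂ} {δ α : ℝ}
    (hP : ∀ t : ℝ, 0 < t → t ≤ 1 → Metric.ball (c + t • w) (t * δ) ⊆ P) (hα : 0 < α)
    {v : ℂ → ℂ} (hv : IsWeakDeriv P e (fun y => ((‖y - c‖ ^ (-α) : ℝ) : ℂ)) v)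
    (hv2 : MemLp v 2 (volume.restrict P)) {ψ : ℂ → ℝ} (hψ : ContDiff ℝ ∞ ψ)
    (hψc : HasCompactSupport ψ) (hψs : tsupport ψ ⊆ Metric.ball w δ) :
    ∫ z, fderiv ℝ ψ z e * ‖z‖ ^ (-α) = 0 := by
  set A := ∫ z, fderiv ℝ ψ z e * ‖z‖ ^ (-α) with hA
  set Q := ∫ z, ψ z ^ 2
  set W := ∫ z in P, ‖v z‖ ^ 2
  have hW : Integrable (fun z => ‖v z‖ ^ 2) (volume.restrict P) := hv2.integrable_norm_pow (by simp)
  have bound : ∀ t : ℝ, 0 < t → t ≤ 1 → |A| ≤ t ^ α * (Q + W) := by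
    intro t ht ht1
    set ψt : ℂ → ℝ := fun y => ψ (t⁻¹ • (y - c)) with hψt
    have d1 : ContDiff ℝ ∞ ψt := hψ.comp (by fun_prop)
    have hs : tsupport ψt ⊆ (fun y => t⁻¹ • (y - c)) ⁻¹' tsupport ψ :=
      tsupport_comp_subset_preimage ψ (f := fun y : ℂ => t⁻¹ • (y - c)) (by fun_prop)
    have hsP : tsupport ψt ⊆ P := fun y hy => by
      have h1 := hψs (hs hy)
      refine hP t ht ht1 ?_
      rw [Metric.mem_ball, dist_eq_norm] at h1 ⊢
      have e : y - (c + t • w) = t • (t⁻¹ • (y - c) - w) := by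
        rw [smul_sub, smul_inv_smul₀ ht.ne']; abel
      rw [e, norm_smul, Real.norm_of_nonneg ht.le]
      gcongr
    have d2 : HasCompactSupport ψt := by
      have hh : Topology.IsClosedEmbedding (fun y : ℂ => t⁻¹ • (y - c)) :=
        ((Homeomorph.subRight c).trans
          (Homeomorph.smulOfNeZero t⁻¹ (inv_ne_zero ht.ne'))).isClosedEmbedding
      exact hψc.comp_isClosedEmbedding hh
    have hf : ∀ y, fderiv ℝ ψt y e = t⁻¹ * fderiv ℝ ψ (t⁻¹ • (y - c)) e := fun y => by
      have h1 : HasFDerivAt (fun y : ℂ => t⁻¹ • (y - c))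
          (t⁻¹ • ContinuousLinearMap.id ℝ ℂ) y := ((hasFDerivAt_id (𝕜 := ℝ) y).sub_const c).const_smul t⁻¹
      have h2 := ((hψ.differentiable (by simp)) (t⁻¹ • (y - c))).hasFDerivAt.comp y h1
      rw [show ψt = ψ ∘ (fun y : ℂ => t⁻¹ • (y - c)) from rfl, h2.fderiv]
      simp
    have hwd := hv ψt d1 d2 hsP
    have out : ∀ y, y ∉ P → fderiv ℝ ψt y e = 0 := fun y hy => by
      have : y ∉ tsupport (fun z => fderiv ℝ ψt z e) := fun h =>
        hy (hsP (tsupport_fderiv_apply_subset ℝ e h))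
      exact image_eq_zero_of_notMem_tsupport (f := fun z => fderiv ℝ ψt z e) this
    have scale : ∀ F : ℂ → ℝ, ∫ y, F (t⁻¹ • (y - c)) = t ^ 2 * ∫ z, F z := fun F => by
      rw [integral_sub_right_eq_self (fun y => F (t⁻¹ • y)) c, Measure.integral_comp_inv_smul]
      simp
    have lhs : ∫ y in P, fderiv ℝ ψt y e • ((‖y - c‖ ^ (-α) : ℝ) : ℂ) =
        ((t ^ (1 - α) * A : ℝ) : ℂ) := by
      rw [setIntegral_eq_integral_of_forall_compl_eq_zero fun y hy => by rw [out y hy, zero_smul]]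
      have : ∀ y, fderiv ℝ ψt y e • ((‖y - c‖ ^ (-α) : ℝ) : ℂ) =
          ((t⁻¹ * t ^ (-α) * (fderiv ℝ ψ (t⁻¹ • (y - c)) e * ‖t⁻¹ • (y - c)‖ ^ (-α)) : ℝ) : ℂ) :=
        fun y => by
        rw [hf, Complex.real_smul, ← Complex.ofReal_mul]
        congr 1
        have : ‖y - c‖ ^ (-α) = t ^ (-α) * ‖t⁻¹ • (y - c)‖ ^ (-α) := by
          rw [← Real.mul_rpow ht.le (norm_nonneg _), norm_smul, norm_inv,
            Real.norm_of_nonneg ht.le, mul_inv_cancel_left₀ ht.ne']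
        rw [this]; ring
      simp only [this]
      rw [integral_complex_ofReal, integral_const_mul,
        scale (fun z => fderiv ℝ ψ z e * ‖z‖ ^ (-α)), ← hA]
      norm_cast
      have : t ^ (1 - α) = t⁻¹ * t ^ (-α) * t ^ 2 := by
        rw [← Real.rpow_natCast, ← Real.rpow_neg_one, ← Real.rpow_add ht, ← Real.rpow_add ht]
        congr 1; push_cast; ring
      rw [this]; ring
    have hi1 : Integrable (fun y => ψt y ^ 2) := by
      simp only [sq]
      exact (d1.continuous.mul d1.continuous).integrable_of_hasCompactSupport d2.mul_right
    have rhs : ‖∫ y in P, ψt y • v y‖ ≤ t * (Q + W) := by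
      calc ‖∫ y in P, ψt y • v y‖ ≤ ∫ y in P, (t⁻¹ * ψt y ^ 2 + t * ‖v y‖ ^ 2) := by
            refine norm_integral_le_of_norm_le ((hi1.restrict.const_mul _).add
              (hW.const_mul _)) (Eventually.of_forall fun y => ?_)
            rw [norm_smul, Real.norm_eq_abs, ← sq_abs (ψt y)]
            have h1 : t⁻¹ * |ψt y| ^ 2 + t * ‖v y‖ ^ 2 - 2 * (|ψt y| * ‖v y‖) =
                t⁻¹ * (|ψt y| - t * ‖v y‖) ^ 2 := by field_simp; ring
            have h2 : 0 ≤ t⁻¹ * (|ψt y| - t * ‖v y‖) ^ 2 := by positivity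
            have h3 : 0 ≤ |ψt y| * ‖v y‖ := by positivity
            linarith
        _ = t⁻¹ * (∫ y in P, ψt y ^ 2) + t * W := by
            rw [integral_add (hi1.restrict.const_mul _) (hW.const_mul _), integral_const_mul,
              integral_const_mul]
        _ ≤ t⁻¹ * (∫ y, ψt y ^ 2) + t * W := by
            gcongr ?_ * ?_ + _
            exact setIntegral_le_integral hi1 (Eventually.of_forall fun y => sq_nonneg _)
        _ = t * (Q + W) := by
            rw [scale (fun z => ψ z ^ 2)]
            field_simp
            rfl
    rw [lhs] at hwd
    have h5 : t ^ (1 - α) * |A| ≤ t * (Q + W) := by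
      rw [← norm_neg, ← hwd, Complex.norm_real, norm_mul, Real.norm_of_nonneg (by positivity)] at rhs
      exact rhs
    have h6 : t = t ^ (1 - α) * t ^ α := by
      rw [← Real.rpow_add ht]; simp
    have h7 : t * (Q + W) = t ^ (1 - α) * (t ^ α * (Q + W)) := by
      rw [← mul_assoc, ← h6]
    rw [h7] at h5
    exact le_of_mul_le_mul_left h5 (by positivity)
  have hlim : Tendsto (fun t : ℝ => t ^ α * (Q + W)) (𝓝[>] 0) (𝓝 0) := by
    have : Tendsto (fun t : ℝ => t ^ α * (Q + W)) (𝓝 0) (𝓝 (0 ^ α * (Q + W))) :=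
      ((Real.continuousAt_rpow_const 0 α (Or.inr hα.le)).tendsto).mul_const _
    rw [Real.zero_rpow hα.ne', zero_mul] at this
    exact this.mono_left nhdsWithin_le_nhds
  have := ge_of_tendsto hlim (by
    filter_upwards [Ioc_mem_nhdsGT (zero_lt_one' ℝ)] with t ht
    exact bound t ht.1 ht.2)
  exact abs_nonpos_iff.1 this

lemma MemHPlane.memLp {P : Set ℂ} {θ : ℝ} {m : ℕ} {v : ℂ → ℂ} (h : MemHPlane P θ m v) :
    MemLp v 2 (volume.restrict P) := by
  cases m <;> exact h.1

lemma not_memHPlane_succ_rpow_norm {P : Set ℂ} {c w : ℂ} {δ α : ℝ} (hδ : 0 < δ) (hδw : δ ≤ ‖w‖)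
    (hP : ∀ t : ℝ, 0 < t → t ≤ 1 → Metric.ball (c + t • w) (t * δ) ⊆ P) (hα : 0 < α) (θ : ℝ)
    (m : ℕ) : ¬ MemHPlane P θ (m + 1) (fun y => ((‖y - c‖ ^ (-α) : ℝ) : ℂ)) := by
  rintro ⟨-, ⟨v1, h1, h1'⟩, v2, h2, h2'⟩
  obtain ⟨ψ, a, b, d, h | h⟩ := exists_integral_fderiv_mul_norm_rpow_ne_zero hδ hδw hα
  · exact h (integral_fderiv_mul_norm_rpow_eq_zero hP hα h1 h1'.memLp a b d)
  · exact h (integral_fderiv_mul_norm_rpow_eq_zero hP hα h2 h2'.memLp a b d)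

namespace PolyhedralSurface

variable (S : PolyhedralSurface)

lemma not_memH_pointSingularity {ν : E3} (hν : ν ∈ S.vertices) {α s : ℝ} (h0 : 0 < α)
    (h1 : α < 1) (hs : 1 - α ≤ s) : ¬ S.MemH s (pointSingularity ν α) := by
  classical
  rintro ⟨-, h2, h3⟩
  obtain ⟨p, -, hp⟩ := Finset.mem_image.1 hν
  obtain ⟨w, δ, hδ, hδw, hP⟩ := exists_cone_subset_interior_quad (S.isQuad p.1) p.2
  rcases lt_or_ge s 1 with hs1 | hs1
  · have h4 := (S.le_slobodeckij_surfaceMeasure s _ p.1).trans_lt (h2 (by linarith) hs1)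
    simp only [S.pointSingularity_chart hp] at h4
    exact h4.ne (slobodeckij_rpow_norm_eq_top hδ hδw hP h0 hs (by linarith))
  · have h4 := (h3 hs1).2 p.1
    simp only [S.pointSingularity_chart hp] at h4
    obtain ⟨m, hm⟩ := Nat.exists_eq_add_of_le' (Nat.le_floor (by exact_mod_cast hs1) : 1 ≤ ⌊s⌋₊)
    rw [hm] at h4
    exact not_memHPlane_succ_rpow_norm hδ hδw hP h0 _ m h4

end PolyhedralSurface

/-! ### Polar coordinates at a corner -/

lemma volume_frontier_quad (c : Fin 4 → ℂ) : volume (frontier (quad c)) = 0 := by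
  refine measure_mono_null ((frontier_union_subset _ _).trans
    (union_subset_union inter_subset_left inter_subset_right)) ?_
  exact measure_union_null ((convex_convexHull ℝ _).addHaar_frontier _)
    ((convex_convexHull ℝ _).addHaar_frontier _)

lemma IsQuad.corner_succ_ne {c : Fin 4 → ℂ} (h : IsQuad c) (k : Fin 4) : c (k + 1) ≠ c k := by
  obtain ⟨h1, h2⟩ := h
  intro hk
  fin_cases k <;> simp at hk <;> simp [hk] at h1 h2 <;> linarith

lemma ae_polar_notMem {N : Set ℂ} (hN : volume N = 0) {c u : ℂ} (hu : ‖u‖ = 1) {γ : ℝ}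
    (hγ : γ ≤ 2 * Real.pi) :
    ∀ᵐ r : ℝ ∂(volume.restrict (Ioi (0 : ℝ))), ∀ᵐ θ : ℝ ∂(volume.restrict (Ioo (0 : ℝ) γ)),
      c + (r : ℂ) * Complex.exp ((θ : ℂ) * Complex.I) * u ∉ N := by
  have mp : MeasurePreserving (fun z : ℂ => c - u * z) volume volume :=
    (Measure.measurePreserving_sub_left volume c).comp
      ((rotation ⟨u, by simp [Submonoid.unitSphere, hu]⟩).measurePreserving)
  have hM : ∀ᵐ z : ℂ, c - u * z ∉ N :=
    mp.quasiMeasurePreserving.ae (compl_mem_ae_iff.2 hN)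
  obtain ⟨T, hTN, hTm, hT0⟩ := exists_measurable_superset_of_null (ae_iff.1 hM)
  have h1 := Complex.lintegral_comp_polarCoord_symm (T.indicator 1)
  rw [lintegral_indicator_one hTm, hT0, lintegral_eq_zero_iff (by
    refine Measurable.mul (by fun_prop) ((measurable_one.indicator hTm).comp ?_)
    have : (fun p : ℝ × ℝ => Complex.polarCoord.symm p) =
        fun p => (p.1 : ℂ) * (Real.cos p.2 + Real.sin p.2 * Complex.I) := by
      ext p; rw [Complex.polarCoord_symm_apply]
    change Measurable (fun p : ℝ × ℝ => Complex.polarCoord.symm p)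
    rw [this]
    fun_prop)] at h1
  rw [polarCoord_target, Measure.volume_eq_prod, ← Measure.prod_restrict] at h1
  have h2 := Measure.ae_ae_of_ae_prod h1
  filter_upwards [h2, ae_restrict_mem measurableSet_Ioi] with r hr hr0
  rw [ae_restrict_iff' measurableSet_Ioo] at hr ⊢
  have h3 := (measurePreserving_sub_right volume Real.pi).quasiMeasurePreserving.ae hr
  filter_upwards [h3] with θ hθ hθγ
  have h4 := hθ ⟨by linarith [hθγ.1], by linarith [hθγ.2]⟩
  have hr' : 0 < r := hr0
  simp only [Pi.zero_apply, smul_eq_mul, mul_eq_zero, ENNReal.ofReal_eq_zero,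
    not_le.2 hr', false_or, indicator_apply_eq_zero, Pi.one_apply, one_ne_zero, imp_false] at h4
  have h5 : ¬ ¬ (c - u * (Complex.polarCoord.symm (r, θ - Real.pi)) ∉ N) := fun h => h4 (hTN h)
  rw [not_not, Complex.polarCoord_symm_apply] at h5
  convert h5 using 1
  simp only [Real.cos_sub_pi, Real.sin_sub_pi, Complex.exp_mul_I]
  push_cast
  ring_nf

lemma exists_sectorNormSq_le (γ R : ℝ) {lam : ℝ} (h : lam < 1) :
    ∃ J < (⊤ : ℝ≥0∞), ∀ (M : ℝ) (F : ℝ → ℝ → ℂ), 0 ≤ M →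
      (∀ᵐ r : ℝ ∂(volume.restrict (Ioi (0 : ℝ))), ∀ᵐ θ : ℝ ∂(volume.restrict (Ioo (0 : ℝ) γ)),
        ‖F r θ‖ ≤ M * (Ioc 0 R).indicator (fun r => r ^ (-lam)) r) →
      sectorNormSq γ F ≤ ENNReal.ofReal M ^ 2 * J := by
  refine ⟨∫⁻ r in Ioi (0 : ℝ), (Ioc 0 R).indicator (fun r => ENNReal.ofReal (r ^ (1 - 2 * lam))) r *
    ENNReal.ofReal γ, ?_, fun M F hM hF => ?_⟩
  · rw [lintegral_mul_const' _ _ ENNReal.ofReal_ne_top]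
    refine ENNReal.mul_lt_top ?_ ENNReal.ofReal_lt_top
    rw [setLIntegral_indicator measurableSet_Ioc, inter_eq_left.2 Ioc_subset_Ioi_self]
    rcases le_or_gt R 0 with hR | hR
    · simp [Ioc_eq_empty (not_lt.2 hR)]
    have h1 : IntegrableOn (fun r : ℝ => r ^ (1 - 2 * lam)) (Ioc 0 R) :=
      (integrableOn_Ioc_iff_integrableOn_Ioo).2
        ((intervalIntegral.integrableOn_Ioo_rpow_iff hR).2 (by linarith))
    exact h1.lintegral_lt_top
  · rw [← lintegral_const_mul' _ _ (by simp)]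
    refine lintegral_mono_ae ?_
    filter_upwards [hF, ae_restrict_mem measurableSet_Ioi] with r hr hr0
    calc ∫⁻ θ in Ioo (0 : ℝ) γ, ‖F r θ‖ₑ ^ 2 * ENNReal.ofReal r
        ≤ ∫⁻ θ in Ioo (0 : ℝ) γ, ENNReal.ofReal M ^ 2 *
          (Ioc 0 R).indicator (fun r => ENNReal.ofReal (r ^ (1 - 2 * lam))) r := by
          refine lintegral_mono_ae ?_
          filter_upwards [hr] with θ hθ
          have hr' : 0 < r := hr0
          by_cases hR : r ∈ Ioc 0 R
          · rw [indicator_of_mem hR] at hθ ⊢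
            rw [← ofReal_norm]
            calc _ ≤ ENNReal.ofReal (M * r ^ (-lam)) ^ 2 * ENNReal.ofReal r := by gcongr
              _ = _ := by
                rw [← ENNReal.ofReal_pow (by positivity), ← ENNReal.ofReal_pow hM,
                  ← ENNReal.ofReal_mul (by positivity), ← ENNReal.ofReal_mul (by positivity)]
                congr 1
                have : r ^ (1 - 2 * lam) = (r ^ (-lam)) ^ 2 * r := by
                  rw [← Real.rpow_natCast, ← Real.rpow_mul hr'.le]
                  nth_rewrite 3 [← Real.rpow_one r]
                  rw [← Real.rpow_add hr']
                  congr 1; push_cast; ring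
                rw [this]; ring
          · rw [indicator_of_notMem hR] at hθ ⊢
            have : F r θ = 0 := by simpa using hθ
            simp [this]
      _ = _ := by simp [mul_assoc]

lemma norm_weightedDeriv_le {c : Fin 4 → ℂ} {k : Fin 4} (hk : c (k + 1) ≠ c k) {γ ρ r θ : ℝ}
    (h1 : ρ ≤ 1) (hr : 0 < r) (hθ : θ ∈ Ioo 0 γ) {F : ℂ → ℂ} {F' : ℂ →L[ℝ] ℂ}
    (hF : HasFDerivAt F F' (cornerPolar c k r θ)) :
    ‖weightedDeriv γ ρ 1 0 (fun r θ => F (cornerPolar c k r θ)) r θ‖ ≤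
      (1 + 1 / r) ^ ρ * γ ^ (1 - ρ) * (r * ‖F'‖) ∧
    ‖weightedDeriv γ ρ 0 1 (fun r θ => F (cornerPolar c k r θ)) r θ‖ ≤
      (1 + 1 / r) ^ ρ * γ ^ (1 - ρ) * (r * ‖F'‖) := by
  have hq : 0 < angularDist γ θ := lt_min hθ.1 (by linarith [hθ.2])
  have hqγ : angularDist γ θ ≤ γ := (min_le_left _ _).trans hθ.2.le
  have hqρ : angularDist γ θ ^ (1 - ρ) ≤ γ ^ (1 - ρ) :=
    Real.rpow_le_rpow hq.le hqγ (by linarith)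
  set q := angularDist γ θ
  have hu : ‖(c (k + 1) - c k) / ((‖c (k + 1) - c k‖ : ℝ) : ℂ)‖ = 1 := by
    rw [norm_div, Complex.norm_real, norm_norm, div_self]
    exact norm_ne_zero_iff.2 (sub_ne_zero.2 hk)
  set u := (c (k + 1) - c k) / ((‖c (k + 1) - c k‖ : ℝ) : ℂ)
  have hw : 0 ≤ (1 + 1 / r) ^ ρ := by positivity
  have hγρ : 0 ≤ γ ^ (1 - ρ) := Real.rpow_nonneg (hq.le.trans hqγ) _
  have nexp : ‖Complex.exp ((θ : ℂ) * Complex.I)‖ = 1 := Complex.norm_exp_ofReal_mul_I θ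
  constructor
  · have d1 : HasDerivAt (fun r' : ℝ => cornerPolar c k r' θ)
        (Complex.exp ((θ : ℂ) * Complex.I) * u) r := by
      have := ((((Complex.ofRealCLM.hasDerivAt (x := r)).mul_const
        (Complex.exp ((θ : ℂ) * Complex.I))).mul_const u).const_add (c k))
      simpa [cornerPolar, u] using this
    have d2 : HasDerivAt (fun r' : ℝ => (q ^ ((0 : ℕ) - ρ : ℝ) : ℝ) • F (cornerPolar c k r' θ))
        ((q ^ ((0 : ℕ) - ρ : ℝ) : ℝ) • F' (Complex.exp ((θ : ℂ) * Complex.I) * u)) r :=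
      (hF.comp_hasDerivAt r d1).const_smul (q ^ ((0 : ℕ) - ρ : ℝ))
    have nF : ‖F' (Complex.exp ((θ : ℂ) * Complex.I) * u)‖ ≤ ‖F'‖ := by
      simpa [nexp, hu] using F'.le_opNorm (Complex.exp ((θ : ℂ) * Complex.I) * u)
    simp only [weightedDeriv, iteratedDeriv_zero, iteratedDeriv_one, pow_one]
    rw [d2.deriv, norm_smul, norm_smul, Real.norm_of_nonneg (by positivity),
      Real.norm_of_nonneg (by positivity)]
    have e : q ^ (1 - ρ) = q * q ^ ((0 : ℕ) - ρ : ℝ) := by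
      rw [show (1 - ρ : ℝ) = 1 + ((0 : ℕ) - ρ) by push_cast; ring, Real.rpow_add hq, Real.rpow_one]
    calc _ ≤ (1 + 1 / r) ^ ρ * (q * r) * (q ^ ((0 : ℕ) - ρ : ℝ) * ‖F'‖) := by gcongr
      _ = (1 + 1 / r) ^ ρ * q ^ (1 - ρ) * (r * ‖F'‖) := by rw [e]; ring
      _ ≤ _ := by gcongr
  · have d1 : HasDerivAt (fun θ' : ℝ => cornerPolar c k r θ')
        (r * (Complex.exp ((θ : ℂ) * Complex.I) * Complex.I) * u) θ := by
      have h3 : HasDerivAt (fun θ' : ℝ => Complex.exp ((θ' : ℂ) * Complex.I))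
          (Complex.exp ((θ : ℂ) * Complex.I) * Complex.I) θ := by
        simpa using ((Complex.ofRealCLM.hasDerivAt (x := θ)).mul_const Complex.I).cexp
      simpa [cornerPolar, u] using ((h3.const_mul (r : ℂ)).mul_const u).const_add (c k)
    have d2 : HasDerivAt (fun θ' : ℝ => F (cornerPolar c k r θ'))
        (F' (r * (Complex.exp ((θ : ℂ) * Complex.I) * Complex.I) * u)) θ :=
      hF.comp_hasDerivAt θ d1
    have nF : ‖F' (r * (Complex.exp ((θ : ℂ) * Complex.I) * Complex.I) * u)‖ ≤ r * ‖F'‖ := by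
      have := F'.le_opNorm (r * (Complex.exp ((θ : ℂ) * Complex.I) * Complex.I) * u)
      simpa [nexp, hu, abs_of_pos hr, mul_comm] using this
    simp only [weightedDeriv, iteratedDeriv_zero, iteratedDeriv_one, pow_zero, mul_one,
      Nat.cast_one]
    rw [d2.deriv, norm_smul, norm_smul, Real.norm_of_nonneg hw,
      Real.norm_of_nonneg (by positivity)]
    calc _ ≤ (1 + 1 / r) ^ ρ * (γ ^ (1 - ρ) * (r * ‖F'‖)) := by gcongr
      _ = _ := by ring

lemma norm_cornerPolar_sub {c : Fin 4 → ℂ} {k : Fin 4} (hk : c (k + 1) ≠ c k) {r θ : ℝ}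
    (hr : 0 ≤ r) : ‖cornerPolar c k r θ - c k‖ = r := by
  rw [cornerPolar, add_sub_cancel_left, norm_mul, norm_mul, norm_div, Complex.norm_real,
    Complex.norm_real, norm_norm, div_self (norm_ne_zero_iff.2 (sub_ne_zero.2 hk)),
    Complex.norm_exp_ofReal_mul_I, Real.norm_of_nonneg hr, mul_one, mul_one]

lemma cornerAngle_le (c : Fin 4 → ℂ) (k : Fin 4) : cornerAngle c k ≤ 2 * Real.pi := by
  have := toIcoMod_lt_right Real.two_pi_pos 0
    (Complex.arg ((c (k - 1) - c k) / (c (k + 1) - c k)))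
  rw [zero_add] at this
  exact this.le

lemma cornerAngle_nonneg (c : Fin 4 → ℂ) (k : Fin 4) : 0 ≤ cornerAngle c k :=
  left_le_toIcoMod _ _ _

lemma corner_mem_quad (c : Fin 4 → ℂ) (k : Fin 4) : c k ∈ quad c := by
  by_cases hk : k = 3
  · exact Or.inr (subset_convexHull ℝ _ (by simp [hk]))
  · refine Or.inl (subset_convexHull ℝ _ ?_)
    fin_cases k <;> simp at hk ⊢

/-- A function on a quadrilateral that decays like a power of the distance to a corner, together
with its gradient, has bounded weighted norms in the polar coordinates of this corner. -/
lemma exists_sectorNormSq_indicator_le {c : Fin 4 → ℂ} (hc : IsQuad c) (k : Fin 4) {lam ρ : ℝ}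
    (hρ0 : 0 ≤ ρ) (hρ1 : ρ ≤ 1) (h : lam + ρ < 1) :
    ∃ J < (⊤ : ℝ≥0∞), ∀ (M : ℝ) (F : ℂ → ℂ) (N : Set ℂ), 0 ≤ M → volume N = 0 →
      (∀ y ∈ interior (quad c), y ∉ N → y ≠ c k → DifferentiableAt ℝ F y ∧
        ‖F y‖ ≤ M * ‖y - c k‖ ^ (-lam) ∧ ‖fderiv ℝ F y‖ ≤ M * ‖y - c k‖ ^ (-lam - 1)) →
      sectorNormSq (cornerAngle c k)
        (fun r θ => (quad c).indicator F (cornerPolar c k r θ)) ≤ ENNReal.ofReal M ^ 2 * J ∧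
      sectorNormSq (cornerAngle c k) (weightedDeriv (cornerAngle c k) ρ 1 0
        (fun r θ => (quad c).indicator F (cornerPolar c k r θ))) ≤ ENNReal.ofReal M ^ 2 * J ∧
      sectorNormSq (cornerAngle c k) (weightedDeriv (cornerAngle c k) ρ 0 1
        (fun r θ => (quad c).indicator F (cornerPolar c k r θ))) ≤ ENNReal.ofReal M ^ 2 * J := by
  have hk := hc.corner_succ_ne k
  obtain ⟨R, hR0, hR⟩ := (isCompact_quad c).isBounded.subset_closedBall_lt 0 (c k)
  set γ := cornerAngle c k
  have hγ : 0 ≤ γ := cornerAngle_nonneg c k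
  obtain ⟨J, hJ, hJ'⟩ := exists_sectorNormSq_le γ R h
  set D := (R + 1) ^ ρ * (1 + γ ^ (1 - ρ))
  have hγρ : 0 ≤ γ ^ (1 - ρ) := by positivity
  refine ⟨ENNReal.ofReal D ^ 2 * J, ENNReal.mul_lt_top (by simp) hJ,
    fun M F N hM hN hF => ?_⟩
  have hu : ‖(c (k + 1) - c k) / ((‖c (k + 1) - c k‖ : ℝ) : ℂ)‖ = 1 := by
    rw [norm_div, Complex.norm_real, norm_norm, div_self]
    exact norm_ne_zero_iff.2 (sub_ne_zero.2 hk)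
  have hae := ae_polar_notMem (measure_union_null (volume_frontier_quad c) hN) (c := c k) hu
    (cornerAngle_le c k)
  have key : ∀ᵐ r : ℝ ∂(volume.restrict (Ioi (0 : ℝ))), ∀ᵐ θ : ℝ ∂(volume.restrict (Ioo (0 : ℝ) γ)),
      0 < r ∧ θ ∈ Ioo 0 γ ∧ ∃ F' : ℂ →L[ℝ] ℂ,
        HasFDerivAt ((quad c).indicator F) F' (cornerPolar c k r θ) ∧
        ‖(quad c).indicator F (cornerPolar c k r θ)‖ ≤
          M * (Ioc 0 R).indicator (fun r => r ^ (-lam)) r ∧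
        ‖F'‖ ≤ M * (Ioc 0 R).indicator (fun r => r ^ (-lam - 1)) r := by
    filter_upwards [hae, ae_restrict_mem measurableSet_Ioi] with r hr (hr0 : 0 < r)
    filter_upwards [hr, ae_restrict_mem measurableSet_Ioo] with θ hθ hθγ
    refine ⟨hr0, hθγ, ?_⟩
    rw [mem_union, not_or] at hθ
    obtain ⟨hθ1, hθ2⟩ := hθ
    change cornerPolar c k r θ ∉ _ at hθ1
    change cornerPolar c k r θ ∉ _ at hθ2
    have hnr := norm_cornerPolar_sub hk (θ := θ) hr0.le
    set y := cornerPolar c k r θ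
    by_cases hy : y ∈ quad c
    · have hyi : y ∈ interior (quad c) := by
        by_contra hyi
        exact hθ1 ⟨subset_closure hy, hyi⟩
      obtain ⟨f1, f2, f3⟩ := hF y hyi hθ2 (by
        rintro hyc; rw [hyc, sub_self, norm_zero] at hnr; exact hr0.ne hnr)
      have hrR : r ∈ Ioc 0 R := ⟨hr0, by rw [← hnr, ← dist_eq_norm]; exact hR hy⟩
      have heq : (quad c).indicator F =ᶠ[𝓝 y] F := by
        filter_upwards [mem_interior_iff_mem_nhds.1 hyi] with z hz
        exact indicator_of_mem hz F
      refine ⟨_, f1.hasFDerivAt.congr_of_eventuallyEq heq, ?_, ?_⟩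
      · rw [indicator_of_mem hrR, heq.self_of_nhds, ← hnr]; exact f2
      · rw [indicator_of_mem hrR, ← hnr]; exact f3
    · have heq : (quad c).indicator F =ᶠ[𝓝 y] fun _ => 0 := by
        filter_upwards [(isCompact_quad c).isClosed.isOpen_compl.mem_nhds hy] with z hz
        exact indicator_of_notMem hz F
      have hnn : ∀ p : ℝ, 0 ≤ M * (Ioc 0 R).indicator (fun r => r ^ p) r := fun p =>
        mul_nonneg hM (indicator_nonneg (fun x hx => Real.rpow_nonneg hx.1.le _) _)
      refine ⟨0, (hasFDerivAt_const 0 y).congr_of_eventuallyEq heq, ?_, ?_⟩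
      · rw [heq.self_of_nhds, norm_zero]; exact hnn _
      · rw [norm_zero]; exact hnn _
  have hMD : ENNReal.ofReal M ^ 2 * (ENNReal.ofReal D ^ 2 * J) =
      ENNReal.ofReal (M * D) ^ 2 * J := by
    rw [ENNReal.ofReal_mul hM]; ring
  have hMD0 : 0 ≤ M * D := by positivity
  have weight : ∀ r ∈ Ioc 0 R, ∀ a : ℝ, 0 ≤ a → a ≤ M * r ^ (-lam - 1) →
      (1 + 1 / r) ^ ρ * γ ^ (1 - ρ) * (r * a) ≤ M * D * r ^ (-(lam + ρ)) := by
    intro r hr a ha ham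
    have hr0 := hr.1
    have e1 : 1 + 1 / r ≤ (R + 1) / r := by
      rw [le_div_iff₀ hr0]; field_simp; linarith [hr.2]
    calc (1 + 1 / r) ^ ρ * γ ^ (1 - ρ) * (r * a)
        ≤ ((R + 1) / r) ^ ρ * (1 + γ ^ (1 - ρ)) * (r * (M * r ^ (-lam - 1))) := by
          gcongr
          linarith
      _ = M * D * (r ^ (-ρ) * (r * r ^ (-lam - 1))) := by
          rw [Real.div_rpow (by linarith) hr0.le, Real.rpow_neg hr0.le ρ]
          simp only [D]
          field_simp
      _ = _ := by
          nth_rewrite 2 [← Real.rpow_one r]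
          rw [← Real.rpow_add hr0, ← Real.rpow_add hr0]
          congr 2; ring
  rw [hMD]
  refine ⟨hJ' _ _ hMD0 ?_, hJ' _ _ hMD0 ?_, hJ' _ _ hMD0 ?_⟩
  · filter_upwards [key] with r hr
    filter_upwards [hr] with θ hrθ
    obtain ⟨hr0, -, F', -, hb, -⟩ := hrθ
    refine hb.trans ?_
    by_cases hrR : r ∈ Ioc 0 R
    · rw [indicator_of_mem hrR, indicator_of_mem hrR]
      have e : r ^ (-lam) = r ^ ρ * r ^ (-(lam + ρ)) := by
        rw [← Real.rpow_add hr0]; congr 1; ring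
      have e2 : r ^ ρ ≤ D := by
        have : r ^ ρ ≤ (R + 1) ^ ρ := Real.rpow_le_rpow hr0.le (by linarith [hrR.2]) hρ0
        exact this.trans (le_mul_of_one_le_right (by positivity) (by linarith))
      rw [e, ← mul_assoc]
      gcongr
    · simp [indicator_of_notMem hrR]
  all_goals
    filter_upwards [key] with r hr
    filter_upwards [hr] with θ hrθ
    obtain ⟨hr0, hθ, F', hF', -, hb⟩ := hrθ
    have hw := norm_weightedDeriv_le hk hρ1 hr0 hθ hF'
    by_cases hrR : r ∈ Ioc 0 R
    · rw [indicator_of_mem hrR] at hb ⊢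
      first
      | exact hw.1.trans (weight r hrR _ (norm_nonneg _) hb)
      | exact hw.2.trans (weight r hrR _ (norm_nonneg _) hb)
    · rw [indicator_of_notMem hrR, mul_zero] at hb ⊢
      have h0 : ‖F'‖ = 0 := le_antisymm hb (norm_nonneg _)
      simp only [h0, mul_zero] at hw
      first
      | exact hw.1
      | exact hw.2

/-! ### Bounds for the weighted norm -/

namespace PolyhedralSurface

variable (S : PolyhedralSurface)

lemma chart_eq (i : Fin S.numPatches) : (S.chart i : ℂ → E3) =
    fun y => (S.chart i).linearIsometry.toContinuousLinearMap y + S.chart i 0 := by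
  ext1 y
  have := (S.chart i).map_vadd 0 y
  simpa using this

lemma hasFDerivAt_chart (i : Fin S.numPatches) (y : ℂ) :
    HasFDerivAt (S.chart i) (S.chart i).linearIsometry.toContinuousLinearMap y := by
  rw [S.chart_eq]
  exact (ContinuousLinearMap.hasFDerivAt _).add_const _

lemma contDiff_chart (i : Fin S.numPatches) : ContDiff ℝ ∞ (S.chart i) := by
  rw [S.chart_eq]
  fun_prop

lemma pwSmooth_of_contDiff {u : E3 → ℂ} (hu : ContDiff ℝ ∞ u) : S.PwSmooth u :=
  ⟨hu.continuous.continuousOn, fun i => ⟨_, hu.comp (S.contDiff_chart i), fun _ _ => rfl⟩⟩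

lemma chart_mem_surface {i : Fin S.numPatches} {y : ℂ} (hy : y ∈ quad (S.corner i)) :
    S.chart i y ∈ S.surface := by
  rw [surface, S.frontier_eq]
  exact mem_iUnion.2 ⟨i, y, hy, rfl⟩

variable {S} {φ : E3 → E3 → ℝ}

/-- The cut-off function of a vertex vanishes near all other vertices. -/
lemma IsVertexPartition.notMem_closure (hφ : S.IsVertexPartition φ) {ν ν' : E3}
    (hν : ν ∈ S.vertices) (hν' : ν' ∈ S.vertices) (hne : ν' ≠ ν) :
    ν ∉ closure {x | x ∈ S.surface ∧ φ ν' x ≠ 0} := by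
  classical
  intro hcl
  obtain ⟨⟨i, l⟩, -, hl⟩ := Finset.mem_image.1 hν
  obtain ⟨k, hk, z, hz, hzν⟩ := hφ.support ν' hν' ν hcl i
    ⟨S.corner i l, corner_mem_quad _ _, hl⟩
  have hz' : z = S.corner i l := (S.chart i).injective (hzν.trans hl.symm)
  subst hz'
  have h1 := hz.2
  have a1 : S.corner i (k + 1) ∈ quadEdge (S.corner i) (k + 1) := left_mem_segment ℝ _ _
  have a2 : S.corner i (k + 2) ∈ quadEdge (S.corner i) (k + 2) := left_mem_segment ℝ _ _
  have a3 : S.corner i (k + 2 + 1) ∈ quadEdge (S.corner i) (k + 2) := right_mem_segment ℝ _ _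
  rw [mem_union, not_or] at h1
  have h2 : l = k ∨ l = k + 1 ∨ l = k + 2 ∨ l = k + 2 + 1 := by
    clear * -
    revert l k; decide
  rcases h2 with rfl | rfl | rfl | rfl
  · exact hne (hk.symm.trans hl)
  · exact h1.1 a1
  · exact h1.2 a2
  · exact h1.2 a3

lemma IsVertexPartition.exists_mul_norm_le (hφ : S.IsVertexPartition φ) {ν ν' : E3}
    (hν : ν ∈ S.vertices) (hν' : ν' ∈ S.vertices) {p : Fin S.numPatches × Fin 4}
    (hp : S.cornerPoint p = ν') :
    ∃ κ : ℝ, 0 < κ ∧ ∀ y ∈ interior (quad (S.corner p.1)),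
      (∀ᶠ z in 𝓝 y, z ∈ quad (S.corner p.1) ∧ φ ν' (S.chart p.1 z) = 0) ∨
        κ * ‖y - S.corner p.1 p.2‖ ≤ ‖S.chart p.1 y - ν‖ := by
  by_cases hne : ν' = ν
  · subst hne
    refine ⟨1, one_pos, fun y _ => Or.inr ?_⟩
    rw [← hp, cornerPoint, ← dist_eq_norm (S.chart p.1 y), (S.chart p.1).isometry.dist_eq,
      dist_eq_norm, one_mul]
  · have h := hφ.notMem_closure hν hν' hne
    obtain ⟨δ, hδ, hb⟩ := Metric.isOpen_iff.1 isClosed_closure.isOpen_compl ν h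
    obtain ⟨R, hR0, hR⟩ :=
      (isCompact_quad (S.corner p.1)).isBounded.subset_closedBall_lt 0 (S.corner p.1 p.2)
    refine ⟨δ / R, by positivity, fun y hy => ?_⟩
    rcases lt_or_ge ‖S.chart p.1 y - ν‖ δ with hlt | hge
    · left
      have h1 : ∀ᶠ z in 𝓝 y, S.chart p.1 z ∈ Metric.ball ν δ :=
        (S.chart p.1).isometry.continuous.continuousAt.eventually_mem
          (Metric.isOpen_ball.mem_nhds (by rwa [Metric.mem_ball, dist_eq_norm]))
      filter_upwards [h1, mem_interior_iff_mem_nhds.1 hy] with z hz hzq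
      refine ⟨hzq, ?_⟩
      by_contra hcon
      exact hb hz (subset_closure ⟨S.chart_mem_surface hzq, hcon⟩)
    · right
      have := hR (interior_subset hy)
      rw [Metric.mem_closedBall, dist_eq_norm] at this
      calc δ / R * ‖y - S.corner p.1 p.2‖ ≤ δ / R * R := by gcongr
        _ = δ := by field_simp
        _ ≤ _ := hge

lemma volume_preimage_chart_singleton (i : Fin S.numPatches) (ν : E3) :
    volume (S.chart i ⁻¹' {ν}) = 0 :=
  (subsingleton_singleton.preimage (S.chart i).injective).measure_zero volume

lemma IsVertexPartition.exists_face_bound (hφ : S.IsVertexPartition φ) {ν ν' : E3}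
    (hν : ν ∈ S.vertices) (hν' : ν' ∈ S.vertices) {p : Fin S.numPatches × Fin 4}
    (hp : S.cornerPoint p = ν') {lam : ℝ} (h0 : 0 ≤ lam) :
    ∃ D : ℝ, 0 ≤ D ∧ ∀ (u : E3 → ℂ) (η : ℝ), 0 ≤ η → Differentiable ℝ u →
      (∀ x ≠ ν, ‖u x‖ ≤ η * ‖x - ν‖ ^ (-lam)) →
      (∀ x ≠ ν, ‖fderiv ℝ u x‖ ≤ η * ‖x - ν‖ ^ (-lam - 1)) →
      ∀ y ∈ interior (quad (S.corner p.1)), y ∉ S.chart p.1 ⁻¹' {ν} → y ≠ S.corner p.1 p.2 →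
        DifferentiableAt ℝ (fun y => (φ ν' (S.chart p.1 y) : ℂ) * u (S.chart p.1 y)) y ∧
        ‖(φ ν' (S.chart p.1 y) : ℂ) * u (S.chart p.1 y)‖ ≤
          D * η * ‖y - S.corner p.1 p.2‖ ^ (-lam) ∧
        ‖fderiv ℝ (fun y => (φ ν' (S.chart p.1 y) : ℂ) * u (S.chart p.1 y)) y‖ ≤
          D * η * ‖y - S.corner p.1 p.2‖ ^ (-lam - 1) := by
  set i := p.1
  set c := S.corner i p.2
  obtain ⟨κ, hκ, hdich⟩ := hφ.exists_mul_norm_le hν hν' hp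
  obtain ⟨Φ, hΦ, hΦ'⟩ := (hφ.pwSmooth ν' hν').2 i
  have hΦe : ∀ y ∈ quad (S.corner i), (φ ν' (S.chart i y) : ℂ) = Φ y := hΦ'
  have hcomp := isCompact_quad (S.corner i)
  obtain ⟨R, hR0, hR⟩ := hcomp.isBounded.subset_closedBall_lt 0 c
  obtain ⟨B1, hB1⟩ := hcomp.exists_bound_of_continuousOn hΦ.continuous.continuousOn
  obtain ⟨B2, hB2⟩ := hcomp.exists_bound_of_continuousOn
    (hΦ.continuous_fderiv (by simp)).continuousOn
  have hB1' : 0 ≤ B1 := (norm_nonneg _).trans (hB1 _ (corner_mem_quad _ 0))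
  have hB2' : 0 ≤ B2 := (norm_nonneg _).trans (hB2 _ (corner_mem_quad _ 0))
  refine ⟨B1 * κ ^ (-lam) + (B2 * κ ^ (-lam) * R + B1 * κ ^ (-lam - 1)), by positivity,
    fun u η hη hu hu0 hu1 y hy hyν hyc => ?_⟩
  have hr : 0 < ‖y - c‖ := norm_pos_iff.2 (sub_ne_zero.2 hyc)
  rcases hdich y hy with hz | hge
  · have heq : (fun y => (φ ν' (S.chart i y) : ℂ) * u (S.chart i y)) =ᶠ[𝓝 y] fun _ => 0 := by
      filter_upwards [hz] with z hz
      simp [i, hz.2]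
    refine ⟨(differentiableAt_const 0).congr_of_eventuallyEq heq, ?_, ?_⟩
    · rw [show (φ ν' (S.chart i y) : ℂ) * u (S.chart i y) = 0 from heq.self_of_nhds, norm_zero]
      positivity
    · rw [heq.fderiv_eq, fderiv_fun_const]
      simp only [Pi.zero_apply, norm_zero]
      positivity
  · have hxν : S.chart i y ≠ ν := hyν
    have pow : ∀ m : ℝ, 0 ≤ m → ‖S.chart i y - ν‖ ^ (-m) ≤ κ ^ (-m) * ‖y - c‖ ^ (-m) := by
      intro m hm
      rw [← Real.mul_rpow hκ.le hr.le]
      exact Real.rpow_le_rpow_of_nonpos (by positivity) hge (by linarith)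
    have b0 : ‖u (S.chart i y)‖ ≤ η * (κ ^ (-lam) * ‖y - c‖ ^ (-lam)) :=
      (hu0 _ hxν).trans (by gcongr; exact pow lam h0)
    have b1 : ‖fderiv ℝ u (S.chart i y)‖ ≤ η * (κ ^ (-lam - 1) * ‖y - c‖ ^ (-lam - 1)) := by
      refine (hu1 _ hxν).trans ?_
      have := pow (lam + 1) (by linarith)
      rw [neg_add'] at this
      gcongr
    have hyq := interior_subset hy
    have hyR : ‖y - c‖ ≤ R := by simpa [dist_eq_norm] using hR hyq
    have hpw : ‖y - c‖ ^ (-lam) ≤ R * ‖y - c‖ ^ (-lam - 1) := by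
      have : ‖y - c‖ ^ (-lam) = ‖y - c‖ * ‖y - c‖ ^ (-lam - 1) := by
        nth_rewrite 2 [← Real.rpow_one ‖y - c‖]
        rw [← Real.rpow_add hr]; congr 1; ring
      rw [this]; gcongr
    have heq : (fun y => (φ ν' (S.chart i y) : ℂ) * u (S.chart i y)) =ᶠ[𝓝 y]
        fun y => Φ y * u (S.chart i y) := by
      filter_upwards [mem_interior_iff_mem_nhds.1 hy] with z hz
      rw [hΦe z hz]
    have d1 := ((hΦ.differentiable (by simp)) y).hasFDerivAt
    have d2 := (hu (S.chart i y)).hasFDerivAt.comp y (S.hasFDerivAt_chart i y)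
    have d3 := (d1.mul d2).congr_of_eventuallyEq heq
    set L := (S.chart i).linearIsometry.toContinuousLinearMap
    have nL : ‖(fderiv ℝ u (S.chart i y)).comp L‖ ≤ ‖fderiv ℝ u (S.chart i y)‖ := by
      refine ((fderiv ℝ u (S.chart i y)).opNorm_comp_le L).trans ?_
      exact mul_le_of_le_one_right (norm_nonneg _)
        (S.chart i).linearIsometry.norm_toContinuousLinearMap_le
    refine ⟨d3.differentiableAt, ?_, ?_⟩
    · rw [hΦe y hyq, norm_mul]
      calc _ ≤ B1 * (η * (κ ^ (-lam) * ‖y - c‖ ^ (-lam))) :=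
            mul_le_mul (hB1 y hyq) b0 (norm_nonneg _) hB1'
        _ = (B1 * κ ^ (-lam)) * η * ‖y - c‖ ^ (-lam) := by ring
        _ ≤ _ := by
          gcongr
          exact le_add_of_nonneg_right (by positivity)
    · rw [d3.fderiv]
      calc _ ≤ ‖Φ y‖ * ‖(fderiv ℝ u (S.chart i y)).comp L‖ +
            ‖u (S.chart i y)‖ * ‖fderiv ℝ Φ y‖ := by
            refine (norm_add_le _ _).trans ?_
            rw [norm_smul, norm_smul]
            rfl
        _ ≤ B1 * (η * (κ ^ (-lam - 1) * ‖y - c‖ ^ (-lam - 1))) +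
            η * (κ ^ (-lam) * (R * ‖y - c‖ ^ (-lam - 1))) * B2 := by
            gcongr
            · exact hB1 y hyq
            · exact nL.trans b1
            · exact b0.trans (by gcongr)
            · exact hB2 y hyq
        _ = (B2 * κ ^ (-lam) * R + B1 * κ ^ (-lam - 1)) * η * ‖y - c‖ ^ (-lam - 1) := by ring
        _ ≤ _ := by
          refine mul_le_mul_of_nonneg_right (mul_le_mul_of_nonneg_right ?_ hη) (by positivity)
          exact le_add_of_nonneg_left (by positivity)

/-- A function with a point singularity of order `lam` at a vertex has finite norm in `X¹_ρ` if
`lam + ρ < 1`. -/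
lemma IsVertexPartition.exists_normX_le (hφ : S.IsVertexPartition φ) {ν : E3}
    (hν : ν ∈ S.vertices) {lam ρ : ℝ} (h0 : 0 ≤ lam) (hρ : 0 ≤ ρ) (h : lam + ρ < 1) :
    ∃ C < (⊤ : ℝ≥0∞), ∀ (u : E3 → ℂ) (η : ℝ), 0 ≤ η → Differentiable ℝ u →
      (∀ x ≠ ν, ‖u x‖ ≤ η * ‖x - ν‖ ^ (-lam)) →
      (∀ x ≠ ν, ‖fderiv ℝ u x‖ ≤ η * ‖x - ν‖ ^ (-lam - 1)) →
      S.normX φ 1 ρ u ≤ ENNReal.ofReal η * C := by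
  have face : ∀ p : Fin S.numPatches × Fin 4, ∃ J < (⊤ : ℝ≥0∞), ∀ (u : E3 → ℂ) (η : ℝ), 0 ≤ η →
      Differentiable ℝ u → (∀ x ≠ ν, ‖u x‖ ≤ η * ‖x - ν‖ ^ (-lam)) →
      (∀ x ≠ ν, ‖fderiv ℝ u x‖ ≤ η * ‖x - ν‖ ^ (-lam - 1)) →
      let f : E3 → ℂ := fun x => (φ (S.cornerPoint p) x : ℂ) * u x
      let γ := cornerAngle (S.corner p.1) p.2
      sectorNormSq γ (S.faceFun p f) ≤ ENNReal.ofReal η ^ 2 * J ∧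
      sectorNormSq γ (weightedDeriv γ ρ 1 0 (S.faceFun p f)) ≤ ENNReal.ofReal η ^ 2 * J ∧
      sectorNormSq γ (weightedDeriv γ ρ 0 1 (S.faceFun p f)) ≤ ENNReal.ofReal η ^ 2 * J := by
    intro p
    have hν' : S.cornerPoint p ∈ S.vertices := by
      classical
      exact Finset.mem_image_of_mem _ (Finset.mem_univ p)
    obtain ⟨D, hD, hb⟩ := hφ.exists_face_bound hν hν' (p := p) rfl h0
    obtain ⟨J, hJ, hJ'⟩ := exists_sectorNormSq_indicator_le (S.isQuad p.1) p.2 hρ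
      (by linarith) h
    refine ⟨ENNReal.ofReal D ^ 2 * J, ENNReal.mul_lt_top (by simp) hJ,
      fun u η hη hu h1 h2 => ?_⟩
    have := hJ' (D * η) (fun y => (φ (S.cornerPoint p) (S.chart p.1 y) : ℂ) * u (S.chart p.1 y))
      (S.chart p.1 ⁻¹' {ν}) (by positivity) (volume_preimage_chart_singleton _ _)
      (hb u η hη hu h1 h2)
    have e : ENNReal.ofReal (D * η) ^ 2 * J = ENNReal.ofReal η ^ 2 * (ENNReal.ofReal D ^ 2 * J) := by
      rw [ENNReal.ofReal_mul hD]; ring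
    rw [e] at this
    exact this
  choose J hJ hface using face
  have root : ∀ (a b : ℝ≥0∞), (a ^ 2 * b) ^ (1 / 2 : ℝ) = a * b ^ (1 / 2 : ℝ) := fun a b => by
    rw [ENNReal.mul_rpow_of_nonneg _ _ (by norm_num), ← ENNReal.rpow_natCast, ← ENNReal.rpow_mul]
    norm_num
  refine ⟨∑ ν' ∈ S.vertices, ((∑ p ∈ S.facesAt ν', J p) ^ (1 / 2 : ℝ) +
    ∑ p ∈ S.facesAt ν', (J p ^ (1 / 2 : ℝ) + J p ^ (1 / 2 : ℝ))), ?_, ?_⟩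
  · have hr : ∀ a < (⊤ : ℝ≥0∞), a ^ (1 / 2 : ℝ) < ⊤ := fun a ha =>
      ENNReal.rpow_lt_top_of_nonneg (by norm_num) ha.ne
    refine ENNReal.sum_lt_top.2 fun ν' _ => ENNReal.add_lt_top.2 ⟨hr _ ?_, ?_⟩
    · exact ENNReal.sum_lt_top.2 fun p _ => hJ p
    · exact ENNReal.sum_lt_top.2 fun p _ => ENNReal.add_lt_top.2 ⟨hr _ (hJ p), hr _ (hJ p)⟩
  intro u η hη hu h1 h2
  rw [normX, Finset.mul_sum]
  refine Finset.sum_le_sum fun ν' hν' => ?_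
  have hb : ∀ p ∈ S.facesAt ν', _ := fun p hp => by
    have h3 := hface p u η hη hu h1 h2
    have h4 : S.cornerPoint p = ν' := by
      classical
      exact (Finset.mem_filter.1 hp).2
    rw [h4] at h3
    exact h3
  rw [coneNorm, mul_add, ← root, Finset.mul_sum, Finset.mul_sum]
  simp only [Finset.Icc_self, Finset.sum_singleton, Finset.Nat.antidiagonal_succ,
    Finset.Nat.antidiagonal_zero, Finset.map_singleton, Finset.sum_cons]
  gcongr with p hp p hp
  · exact (hb p hp).1
  · rw [mul_add, ← root, add_comm]
    gcongr
    · exact (hb p hp).2.1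
    · exact (hb p hp).2.2

end PolyhedralSurface

/-! ### Regularization of the point singularity -/

/-- The smooth function `x ↦ (|x - ν|² + e)^(-α/2)`, for `e > 0`. -/
noncomputable def regularizedSingularity (ν : E3) (α e : ℝ) (x : E3) : ℂ :=
  (((‖x - ν‖ ^ 2 + e) ^ (-(α / 2)) : ℝ) : ℂ)

lemma contDiff_regularizedSingularity (ν : E3) (α : ℝ) {e : ℝ} (he : 0 < e) :
    ContDiff ℝ ∞ (regularizedSingularity ν α e) := by
  refine Complex.ofRealCLM.contDiff.comp (ContDiff.rpow_const_of_ne ?_ fun x => by positivity)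
  exact ((contDiff_id.sub contDiff_const).norm_sq ℝ).add contDiff_const

lemma hasFDerivAt_regularizedSingularity (ν : E3) (α : ℝ) {e : ℝ} (he : 0 < e) (x : E3) :
    HasFDerivAt (regularizedSingularity ν α e) (Complex.ofRealCLM.comp
      ((-(α / 2) * (‖x - ν‖ ^ 2 + e) ^ (-(α / 2) - 1)) • (2 : ℝ) • innerSL ℝ (x - ν))) x := by
  have h1 : HasFDerivAt (fun x : E3 => ‖x - ν‖ ^ 2 + e) ((2 : ℝ) • innerSL ℝ (x - ν)) x := by
    have := ((hasStrictFDerivAt_norm_sq (x - ν)).hasFDerivAt.comp x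
      ((hasFDerivAt_id (𝕜 := ℝ) x).sub_const ν)).add_const e
    rw [← Nat.cast_smul_eq_nsmul ℝ, ContinuousLinearMap.comp_id] at this
    exact_mod_cast this
  exact Complex.ofRealCLM.hasFDerivAt.comp x (h1.rpow_const (Or.inl (by positivity)))

lemma regularizedSingularity_zero (ν : E3) (α : ℝ) :
    regularizedSingularity ν α 0 = pointSingularity ν α := by
  ext x
  rw [regularizedSingularity, pointSingularity, add_zero, ← Real.rpow_natCast,
    ← Real.rpow_mul (norm_nonneg _)]
  congr 2
  push_cast; ring

lemma sq_add_rpow_neg_sub_le {r e β τ : ℝ} (hr : 0 < r) (he : 0 ≤ e) (hβ : 0 < β) (hβ2 : β ≤ 2)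
    (hτ : 0 ≤ τ) (hτ1 : τ ≤ 1) :
    |(r ^ 2 + e) ^ (-β) - (r ^ 2) ^ (-β)| ≤ 2 * (e ^ τ * r ^ (-(2 * β) - 2 * τ)) := by
  have h := rpow_neg_sub_rpow_neg_le (a := r ^ 2) (by positivity) he hβ hβ2 hτ hτ1
  rw [abs_sub_comm]
  refine h.trans (le_of_eq ?_)
  rw [← Real.rpow_natCast r 2, ← Real.rpow_mul hr.le (2 : ℕ) (-β - τ)]
  congr 3; push_cast; ring

lemma norm_regularizedSingularity_sub_le {ν x : E3} (hx : x ≠ ν) {α e τ : ℝ} (he : 0 ≤ e)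
    (hα : 0 < α) (hα2 : α ≤ 2) (hτ : 0 ≤ τ) (hτ1 : τ ≤ 1) :
    ‖regularizedSingularity ν α e x - pointSingularity ν α x‖ ≤
      2 * e ^ τ * ‖x - ν‖ ^ (-(α + 2 * τ)) := by
  have hr : 0 < ‖x - ν‖ := norm_pos_iff.2 (sub_ne_zero.2 hx)
  have h := sq_add_rpow_neg_sub_le hr he (β := α / 2) (by positivity) (by linarith) hτ hτ1
  rw [← regularizedSingularity_zero, regularizedSingularity, regularizedSingularity,
    ← Complex.ofReal_sub, Complex.norm_real, add_zero, Real.norm_eq_abs]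
  refine h.trans (le_of_eq ?_)
  rw [mul_assoc]; congr 3; ring

lemma norm_fderiv_regularizedSingularity_sub_le {ν x : E3} (hx : x ≠ ν) {α e e' τ : ℝ}
    (he : 0 < e) (he' : 0 < e') (hα : 0 < α) (hα2 : α ≤ 2) (hτ : 0 ≤ τ) (hτ1 : τ ≤ 1) :
    ‖fderiv ℝ (regularizedSingularity ν α e - regularizedSingularity ν α e') x‖ ≤
      4 * (e ^ τ + e' ^ τ) * ‖x - ν‖ ^ (-(α + 2 * τ) - 1) := by
  have hr : 0 < ‖x - ν‖ := norm_pos_iff.2 (sub_ne_zero.2 hx)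
  have d := (hasFDerivAt_regularizedSingularity ν α he x).sub
    (hasFDerivAt_regularizedSingularity ν α he' x)
  rw [d.fderiv, ← ContinuousLinearMap.comp_sub]
  have h := sq_add_rpow_neg_sub_le hr he.le (β := α / 2 + 1) (by positivity) (by linarith) hτ hτ1
  have h' := sq_add_rpow_neg_sub_le hr he'.le (β := α / 2 + 1) (by positivity) (by linarith)
    hτ hτ1
  rw [neg_add'] at h h'
  set a := (‖x - ν‖ ^ 2 + e) ^ (-(α / 2) - 1)
  set b := (‖x - ν‖ ^ 2 + e') ^ (-(α / 2) - 1)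
  set z := (‖x - ν‖ ^ 2) ^ (-(α / 2) - 1)
  set P := ‖x - ν‖ ^ (-(2 * (α / 2 + 1)) - 2 * τ) with hP
  have hab : |a - b| ≤ 2 * (e ^ τ + e' ^ τ) * P := by
    have := abs_sub_le a z b
    rw [abs_sub_comm z b] at this
    linarith
  have hPe : P * ‖x - ν‖ = ‖x - ν‖ ^ (-(α + 2 * τ) - 1) := by
    nth_rewrite 1 [← Real.rpow_one ‖x - ν‖]
    rw [hP, ← Real.rpow_add hr]; congr 1; ring
  have hsub : (-(α / 2) * a) • (2 : ℝ) • innerSL ℝ (x - ν) -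
      (-(α / 2) * b) • (2 : ℝ) • innerSL ℝ (x - ν) =
      (-(α / 2) * a - -(α / 2) * b) • (2 : ℝ) • innerSL ℝ (x - ν) := (sub_smul _ _ _).symm
  rw [hsub]
  calc _ ≤ ‖Complex.ofRealCLM‖ * ‖(-(α / 2) * a - -(α / 2) * b) • (2 : ℝ) • innerSL ℝ (x - ν)‖ :=
        ContinuousLinearMap.opNorm_comp_le _ _
    _ = α * |a - b| * ‖x - ν‖ := by
        rw [Complex.ofRealCLM_norm, norm_smul, norm_smul, innerSL_apply_norm, one_mul,
          ← mul_sub, norm_mul, Real.norm_eq_abs, Real.norm_eq_abs, abs_neg, abs_of_pos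
          (by positivity : 0 < α / 2)]
        norm_num
        ring
    _ ≤ 2 * (2 * (e ^ τ + e' ^ τ) * P) * ‖x - ν‖ := by gcongr
    _ = _ := by rw [← hPe]; ring

lemma norm_regularizedSingularity_le {ν x : E3} (hx : x ≠ ν) {α e : ℝ} (he : 0 ≤ e)
    (hα : 0 ≤ α) : ‖regularizedSingularity ν α e x‖ ≤ 2 * ‖x - ν‖ ^ (-α) := by
  have hr : 0 < ‖x - ν‖ := norm_pos_iff.2 (sub_ne_zero.2 hx)
  have h : (‖x - ν‖ ^ 2 + e) ^ (-(α / 2)) ≤ (‖x - ν‖ ^ 2) ^ (-(α / 2)) :=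
    Real.rpow_le_rpow_of_nonpos (by positivity) (by linarith) (by linarith)
  rw [← Real.rpow_natCast ‖x - ν‖, ← Real.rpow_mul hr.le] at h
  rw [regularizedSingularity, Complex.norm_real, Real.norm_of_nonneg (by positivity),
    ← Real.rpow_natCast ‖x - ν‖]
  rw [show ((2 : ℕ) : ℝ) * -(α / 2) = -α by push_cast; ring] at h
  exact h.trans (le_mul_of_one_le_left (by positivity) (by norm_num))

lemma norm_fderiv_regularizedSingularity_le {ν x : E3} (hx : x ≠ ν) {α e : ℝ} (he : 0 < e)
    (hα : 0 ≤ α) (hα2 : α ≤ 2) :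
    ‖fderiv ℝ (regularizedSingularity ν α e) x‖ ≤ 2 * ‖x - ν‖ ^ (-α - 1) := by
  have hr : 0 < ‖x - ν‖ := norm_pos_iff.2 (sub_ne_zero.2 hx)
  have h : (‖x - ν‖ ^ 2 + e) ^ (-(α / 2) - 1) ≤ (‖x - ν‖ ^ 2) ^ (-(α / 2) - 1) :=
    Real.rpow_le_rpow_of_nonpos (by positivity) (by linarith) (by linarith)
  have e1 : (‖x - ν‖ ^ 2) ^ (-(α / 2) - 1) * ‖x - ν‖ = ‖x - ν‖ ^ (-α - 1) := by
    nth_rewrite 2 [← Real.rpow_one ‖x - ν‖]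
    rw [← Real.rpow_natCast ‖x - ν‖, ← Real.rpow_mul hr.le, ← Real.rpow_add hr]
    congr 1; push_cast; ring
  rw [(hasFDerivAt_regularizedSingularity ν α he x).fderiv]
  calc _ ≤ ‖Complex.ofRealCLM‖ * ‖(-(α / 2) * (‖x - ν‖ ^ 2 + e) ^ (-(α / 2) - 1)) • (2 : ℝ) •
          innerSL ℝ (x - ν)‖ := ContinuousLinearMap.opNorm_comp_le _ _
    _ = α * (‖x - ν‖ ^ 2 + e) ^ (-(α / 2) - 1) * ‖x - ν‖ := by
        rw [Complex.ofRealCLM_norm, norm_smul, norm_smul, innerSL_apply_norm, one_mul,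
          norm_mul, norm_neg, Real.norm_of_nonneg (by positivity : 0 ≤ α / 2),
          Real.norm_of_nonneg (by positivity)]
        norm_num
        ring
    _ ≤ 2 * (‖x - ν‖ ^ 2) ^ (-(α / 2) - 1) * ‖x - ν‖ := by gcongr
    _ = _ := by rw [mul_assoc, e1]

namespace PolyhedralSurface

variable {S : PolyhedralSurface} {φ : E3 → E3 → ℝ}

lemma IsVertexPartition.memX_pointSingularity (hφ : S.IsVertexPartition φ) {ν : E3}
    (hν : ν ∈ S.vertices) {α ρ : ℝ} (h0 : 0 < α) (hρ : 0 ≤ ρ) (hρ1 : ρ < 1 - α) :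
    S.MemX φ 1 ρ (pointSingularity ν α) := by
  refine ⟨S.memLp_pointSingularity ν h0.le (by linarith), ?_⟩
  obtain ⟨τ, hτ0, hτ⟩ : ∃ τ : ℝ, 0 < τ ∧ α + 2 * τ + ρ < 1 :=
    ⟨(1 - α - ρ) / 4, by linarith, by linarith⟩
  set e : ℕ → ℝ := fun j => 1 / ((j : ℝ) + 1) with he_def
  have he : ∀ j, 0 < e j := fun j => by positivity
  have hanti : ∀ {i j}, i ≤ j → e j ^ τ ≤ e i ^ τ := fun {i j} hij =>
    Real.rpow_le_rpow (he j).le (one_div_le_one_div_of_le (by positivity) (by gcongr)) hτ0.le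
  have hlim : Tendsto (fun j => e j ^ τ) atTop (𝓝 0) := by
    have := (tendsto_one_div_add_atTop_nhds_zero_nat (𝕜 := ℝ)).rpow_const (p := τ)
      (Or.inr hτ0.le)
    rwa [Real.zero_rpow hτ0.ne'] at this
  have hlim' : ∀ C < (⊤ : ℝ≥0∞),
      Tendsto (fun j => ENNReal.ofReal (8 * e j ^ τ) * C) atTop (𝓝 0) := fun C hC => by
    have h1 : Tendsto (fun j => ENNReal.ofReal (8 * e j ^ τ)) atTop (𝓝 0) := by
      simpa using ENNReal.tendsto_ofReal (hlim.const_mul 8)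
    simpa using ENNReal.Tendsto.mul_const h1 (Or.inr hC.ne)
  have hsm : ∀ j, ContDiff ℝ ∞ (regularizedSingularity ν α (e j)) := fun j =>
    contDiff_regularizedSingularity ν α (he j)
  refine ⟨fun j => regularizedSingularity ν α (e j), fun j => ⟨S.pwSmooth_of_contDiff (hsm j), ?_⟩,
    fun ε hε => ?_, ?_⟩
  · obtain ⟨C, hC, h⟩ := hφ.exists_normX_le hν h0.le hρ (by linarith : α + ρ < 1)
    exact (h _ 2 (by norm_num) ((hsm j).differentiable (by simp))
      (fun x hx => norm_regularizedSingularity_le hx (he j).le h0.le)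
      (fun x hx => norm_fderiv_regularizedSingularity_le hx (he j) h0.le (by linarith))).trans_lt
      (ENNReal.mul_lt_top ENNReal.ofReal_lt_top hC)
  · obtain ⟨C, hC, h⟩ := hφ.exists_normX_le hν (by positivity) hρ hτ
    obtain ⟨J, hJ⟩ := ((hlim' C hC).eventually_lt_const hε).exists
    refine ⟨J, fun j hj l hl => (h _ (8 * e J ^ τ) (by positivity)
      (((hsm j).differentiable (by simp)).sub ((hsm l).differentiable (by simp)))
      (fun x hx => ?_) (fun x hx => ?_)).trans_lt hJ⟩
    · have h1 := norm_regularizedSingularity_sub_le hx (he j).le h0 (by linarith) hτ0.le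
        (by linarith)
      have h2 := norm_regularizedSingularity_sub_le hx (he l).le h0 (by linarith) hτ0.le
        (by linarith)
      have h3 := norm_sub_le (regularizedSingularity ν α (e j) x - pointSingularity ν α x)
        (regularizedSingularity ν α (e l) x - pointSingularity ν α x)
      rw [sub_sub_sub_cancel_right] at h3
      rw [Pi.sub_apply]
      have h4 := hanti hj
      have h5 := hanti hl
      have h6 : 0 ≤ e J ^ τ := by positivity
      calc _ ≤ (2 * e j ^ τ + 2 * e l ^ τ) * ‖x - ν‖ ^ (-(α + 2 * τ)) := by linarith
        _ ≤ _ := by gcongr; linarith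
    · refine (norm_fderiv_regularizedSingularity_sub_le hx (he j) (he l) h0 (by linarith) hτ0.le
        (by linarith)).trans ?_
      have h4 := hanti hj
      have h5 := hanti hl
      exact mul_le_mul_of_nonneg_right (by linarith) (by positivity)
  · obtain ⟨C, hC, h⟩ := S.exists_eLpNorm_le (lam := α + 2 * τ) (by positivity) (by linarith) ν
    refine tendsto_of_tendsto_of_tendsto_of_le_of_le tendsto_const_nhds (hlim' C hC)
      (fun _ => zero_le) fun j => h _ _ (by positivity) fun x hx => ?_
    refine (norm_regularizedSingularity_sub_le hx (he j).le h0 (by linarith) hτ0.le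
      (by linarith)).trans ?_
    gcongr
    norm_num

end PolyhedralSurface

theorem mainTheorem2 (S : PolyhedralSurface) (φ : E3 → E3 → ℝ) (hφ : S.IsVertexPartition φ)
    (ν : E3) (hν : ν ∈ S.vertices) (α : ℝ) (hα : 1 / 2 ≤ α) (hα' : α < 1) :
    (∀ s ρ : ℝ, 0 ≤ s → s < 1 - α → 0 ≤ ρ → ρ < 1 - α →
      S.MemH s (pointSingularity ν α) ∧ S.MemX φ 1 ρ (pointSingularity ν α)) ∧
    ∀ s : ℝ, 1 - α ≤ s → ¬ S.MemH s (pointSingularity ν α) := by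
  have h0 : 0 < α := by linarith
  refine ⟨fun s ρ _ hs1 hρ hρ1 => ⟨⟨S.memLp_pointSingularity ν h0.le hα', fun hs _ =>
    S.slobodeckij_pointSingularity_lt_top ν h0 hs hs1, fun hs => ?_⟩,
    hφ.memX_pointSingularity hν h0 hρ hρ1⟩, fun s hs => S.not_memH_pointSingularity hν h0 hα' hs⟩
  linarith
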